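/- Let $\Omega_i\subset\mathbb R^3$ be a bounded open set with $C^\infty$ boundary $\Gamma$ (lying locally on one side of $\Gamma$), let $n$ be the unit normal on $\Gamma$ directed to the interior of $\Omega_i$, and let $\varepsilon_r,\omega>0$. Write $(\cdot,\cdot)_\Gamma$ and $\|\cdot\|_\Gamma$ for the Hermitian inner product and norm of $L^2(\Gamma)^3$, and $L^2_t(\Gamma)$ for the space of (complex) fields $\varphi\in L^2(\Gamma)^3$ with $\varphi\cdot n=0$ a.e. Let $\mathcal C=\nabla_\Gamma n$ be the curvature tensor, with principal curvatures $c_1,c_2$, let $\mathcal H=\tfrac12(c_1+c_2)I_\Gamma$, where $I_\Gamma$ is the projection on the tangent plane, and let $\sqrt i=\tfrac{\sqrt2}{2}(1+i)$. Let $\nabla_\Gamma$ be the surface gradient, $-\mathrm{div}_\Gamma$ its $L^2$-adjoint, $\mathrm{curl}_\Gamma V=\mathrm{div}_\Gamma(V\times n)$ and $\mathbf{curl}_\Gamma f=(\nabla_\Gamma f)\times n$, all in the weak sense. For every $\delta>0$ the operators $A^\delta=(1-\delta^2\nabla_\Gamma\mathrm{div}_\Gamma)^{-1}$ and $B^\delta=(1+\delta^2\mathbf{curl}_\Gamma\mathrm{curl}_\Gamma)^{-1}$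 are well defined on $L^2_t(\Gamma)$: for each $\varphi\in L^2_t(\Gamma)$ there are unique $u\in H(\mathrm{div}_\Gamma,\Gamma)$ with $\nabla_\Gamma\mathrm{div}_\Gamma u\in L^2_t(\Gamma)$ and $u-\delta^2\nabla_\Gamma\mathrm{div}_\Gamma u=\varphi$, and $v\in H(\mathrm{curl}_\Gamma,\Gamma)$ with $\mathbf{curl}_\Gamma\mathrm{curl}_\Gamma v\in L^2_t(\Gamma)$ and $v+\delta^2\mathbf{curl}_\Gamma\mathrm{curl}_\Gamma v=\varphi$. Define $$\mathcal D^{\delta,1}=\delta\sqrt i,\qquad \mathcal D^{\delta,2}=\delta\sqrt i+\delta^2(\mathcal H-\mathcal C),$$ $$\begin{aligned}\mathcal D^{\delta,3}={}&\delta\tfrac{\sqrt i}{2}+\delta^2(\mathcal H-\mathcal C)+\tfrac{\delta^3}{2\sqrt i}\left(\mathcal C^2-\mathcal H^2+\varepsilon_r\omega^2\right)+\tfrac{\sqrt2}{4}\,\delta\left(A^\delta+\delta^2\,\mathbf{curl}_\Gamma\mathrm{curl}_\Gamma B^\delta\right)\\&+i\,\tfrac{\sqrt2}{4}\,\delta\left(B^\delta-\delta^2\,\nabla_\Gamma\mathrm{div}_\Gamma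 A^\delta\right).\end{aligned}$$ Let $k\in\{1,2,3\}$. There exist constants $\delta_k>0$, $C_1>0$ and $C_2>0$, independent of $\delta$ and $\varphi$, such that for all $0<\delta\le\delta_k$ and all $\varphi\in L^2_t(\Gamma)$ one has $\mathcal D^{\delta,k}\varphi\in L^2_t(\Gamma)$ and $$\text{(i)}\quad\|\mathcal D^{\delta,k}\varphi\|_\Gamma\le C_1\,\delta\,\|\varphi\|_\Gamma,\qquad\text{(ii)}\quad\operatorname{Re}\,(\mathcal D^{\delta,k}\varphi,\varphi)_\Gamma\ge C_2\,\delta\,\|\varphi\|_\Gamma^2 .$$ -/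

import Mathlib

open MeasureTheory Set Filter Topology
open scoped Matrix

namespace GIBC

noncomputable section

/-- Points and real vectors of the Euclidean space `ℝ³`. -/
abbrev R3 : Type := EuclideanSpace ℝ (Fin 3)

/-- Complex vectors, with the Hermitian norm of `ℂ³`. -/
abbrev C3 : Type := EuclideanSpace ℂ (Fin 3)

/-! ### Smooth domains, their boundary and the normal -/

/-- `ρ` is a smooth local defining function of `Ω` on the open set `U`: its gradient does not
vanish on `U`, and `Ω ∩ U = {y ∈ U | 0 < ρ y}`. Consequently `frontier Ω ∩ U` is the regular
level surface `{y ∈ U | ρ y = 0}` and `Ω` lies on one side of it. -/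
structure IsLocalDefiningFunction (Ω U : Set R3) (ρ : R3 → ℝ) : Prop where
  isOpen : IsOpen U
  contDiffOn : ContDiffOn ℝ (⊤ : ℕ∞) ρ U
  gradient_ne_zero : ∀ y ∈ U, gradient ρ y ≠ 0
  mem_iff : ∀ y ∈ U, (y ∈ Ω ↔ 0 < ρ y)

/-- `Ω` is a bounded open set of `ℝ³` with `C^∞` boundary. -/
structure IsSmoothBounded (Ω : Set R3) : Prop where
  isOpen : IsOpen Ω
  isBounded : Bornology.IsBounded Ω
  smooth_boundary : ∀ x ∈ frontier Ω, ∃ (U : Set R3) (ρ : R3 → ℝ),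
    x ∈ U ∧ IsLocalDefiningFunction Ω U ρ

open scoped Classical in
/-- The unit normal at `x ∈ Γ = frontier Ω` directed to the interior of `Ω`: the normalized
gradient of a local defining function (it does not depend on the choice of that function). -/
def normal (Ω : Set R3) (x : R3) : R3 :=
  if h : ∃ ν : R3, ∃ (U : Set R3) (ρ : R3 → ℝ),
      x ∈ U ∧ IsLocalDefiningFunction Ω U ρ ∧ ν = ‖gradient ρ x‖⁻¹ • gradient ρ x
  then Classical.choose h else 0

/-- The surface measure of `Γ = frontier Ω`: the two-dimensional Hausdorff measure, normalized so
as to be the area on planes, restricted to `Γ`. -/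
def surf (Ω : Set R3) : Measure R3 := (μHE[2] : Measure R3).restrict (frontier Ω)

/-! ### Surface gradient and curvature -/

/-- Orthogonal projection of `v` on the tangent plane of `Γ` at `x`. -/
def tangProj (Ω : Set R3) (x v : R3) : R3 := v - inner ℝ (normal Ω x) v • normal Ω x

/-- The surface gradient `∇_Γ f (x)` of a scalar function `f` on `Γ`. Its `i`-th component is the
derivative of `f` along `Γ` in the direction of the tangential part of the `i`-th basis vector;
this is the gradient at `x` of the extension of `f` which is constant along the normals.
It depends on the values of `f` on `Γ` only. -/
def surfGrad {𝕜 : Type} [RCLike 𝕜] (Ω : Set R3) (f : R3 → 𝕜) (x : R3) : EuclideanSpace 𝕜 (Fin 3) :=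
  WithLp.toLp 2 fun i =>
    fderivWithin ℝ f (frontier Ω) x (tangProj Ω x (EuclideanSpace.single i (1 : ℝ)))

/-- The curvature tensor `𝒞 = ∇_Γ n`: its columns are the surface gradients of the components
of the normal field. -/
def curvature (Ω : Set R3) (x : R3) : Matrix (Fin 3) (Fin 3) ℝ :=
  Matrix.of fun i j => surfGrad Ω (fun y => normal Ω y j) x i

/-- The matrix `I_Γ` of the projection on the tangent plane. -/
def tangId (Ω : Set R3) (x : R3) : Matrix (Fin 3) (Fin 3) ℝ :=
  1 - Matrix.vecMulVec (normal Ω x) (normal Ω x)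

/-- The mean curvature `h = (c₁ + c₂) / 2`; the eigenvalues of `𝒞` are `0` (in the direction of
the normal) and the principal curvatures `c₁`, `c₂`, so that `c₁ + c₂` is the trace of `𝒞`. -/
def meanCurv (Ω : Set R3) (x : R3) : ℝ := (curvature Ω x).trace / 2

/-- The mean curvature tensor `ℋ = h I_Γ`. -/
def meanCurvTensor (Ω : Set R3) (x : R3) : Matrix (Fin 3) (Fin 3) ℝ :=
  meanCurv Ω x • tangId Ω x

/-- A real matrix acting on a complex vector. -/
def act (M : Matrix (Fin 3) (Fin 3) ℝ) (v : C3) : C3 :=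
  WithLp.toLp 2 (M.map Complex.ofReal *ᵥ v.ofLp)

/-! ### Square integrable fields on `Γ` -/

/-- `u · n = ∑ uᵢ nᵢ`, as a function on `Γ`. -/
def dotNormal (Ω : Set R3) (u : R3 → C3) (x : R3) : ℂ := ∑ i, u x i * (normal Ω x i : ℂ)

/-- `u × n`, as a field on `Γ`. -/
def crossNormal (Ω : Set R3) (u : R3 → C3) (x : R3) : C3 :=
  WithLp.toLp 2 ((u x).ofLp ⨯₃ fun i => (normal Ω x i : ℂ))

/-- `u ∈ L²_t(Γ)`: square integrable tangential fields. -/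
def MemL2t (Ω : Set R3) (u : R3 → C3) : Prop :=
  MemLp u 2 (surf Ω) ∧ ∀ᵐ x ∂(surf Ω), dotNormal Ω u x = 0

/-- The inner product `(u, v)_Γ = ∫_Γ u · v̄` of vector fields. -/
def ip (Ω : Set R3) (u v : R3 → C3) : ℂ :=
  ∫ x, ∑ i, u x i * (starRingEnd ℂ) (v x i) ∂(surf Ω)

/-- The inner product of scalar functions in `L²(Γ)`. -/
def ipScalar (Ω : Set R3) (d e : R3 → ℂ) : ℂ := ∫ x, d x * (starRingEnd ℂ) (e x) ∂(surf Ω)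

/-- The norm `‖u‖_Γ` of `L²(Γ)³`. -/
def nrm (Ω : Set R3) (u : R3 → C3) : ℝ := Real.sqrt (∫ x, ‖u x‖ ^ 2 ∂(surf Ω))

/-! ### Surface differential operators in the weak sense -/

/-- `div_Γ u = d` in the sense of distributions: `∫_Γ u · ∇_Γ f = - ∫_Γ d f` for every smooth
function `f` on `Γ` (that is, the restriction to `Γ` of a smooth function on `ℝ³`). -/
def IsSurfDiv (Ω : Set R3) (u : R3 → C3) (d : R3 → ℂ) : Prop :=
  ∀ f : R3 → ℂ, ContDiff ℝ (⊤ : ℕ∞) f →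
    ∫ x, ∑ i, u x i * surfGrad Ω f x i ∂(surf Ω) = - ∫ x, d x * f x ∂(surf Ω)

/-- `curl_Γ u = div_Γ (u × n) = r` (scalar surface curl of a tangential field). -/
def IsSurfCurl (Ω : Set R3) (u : R3 → C3) (r : R3 → ℂ) : Prop :=
  IsSurfDiv Ω (crossNormal Ω u) r

/-- `u ∈ H(div_Γ, Γ)` with `div_Γ u = d`. -/
def MemHdiv (Ω : Set R3) (u : R3 → C3) (d : R3 → ℂ) : Prop :=
  MemL2t Ω u ∧ MemLp d 2 (surf Ω) ∧ IsSurfDiv Ω u d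

/-- `u ∈ H(curl_Γ, Γ)` with `curl_Γ u = r`. -/
def MemHcurl (Ω : Set R3) (u : R3 → C3) (r : R3 → ℂ) : Prop :=
  MemL2t Ω u ∧ MemLp r 2 (surf Ω) ∧ IsSurfCurl Ω u r

/-- `∇_Γ d = g` weakly, with `g ∈ L²_t(Γ)`: `(g, ψ)_Γ = -(d, div_Γ ψ)_Γ` for all
`ψ ∈ H(div_Γ, Γ)`, as `∇_Γ` and `-div_Γ` are adjoint to each other. -/
def IsSurfGrad (Ω : Set R3) (d : R3 → ℂ) (g : R3 → C3) : Prop :=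
  MemL2t Ω g ∧ ∀ (ψ : R3 → C3) (e : R3 → ℂ), MemHdiv Ω ψ e → ip Ω g ψ = - ipScalar Ω d e

/-- The vector surface curl `𝐜𝐮𝐫𝐥_Γ r = (∇_Γ r) × n = g` of a scalar function `r`, weakly. -/
def IsSurfVecCurl (Ω : Set R3) (r : R3 → ℂ) (g : R3 → C3) : Prop :=
  ∃ G : R3 → C3, IsSurfGrad Ω r G ∧ g =ᵐ[surf Ω] crossNormal Ω G

/-- `∇_Γ div_Γ u = g`. -/
def IsGradDiv (Ω : Set R3) (u g : R3 → C3) : Prop :=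
  ∃ d : R3 → ℂ, MemHdiv Ω u d ∧ IsSurfGrad Ω d g

/-- `𝐜𝐮𝐫𝐥_Γ curl_Γ u = g`. -/
def IsCurlCurl (Ω : Set R3) (u g : R3 → C3) : Prop :=
  ∃ r : R3 → ℂ, MemHcurl Ω u r ∧ IsSurfVecCurl Ω r g

/-! ### The resolvents -/

/-- `(u, g)` is a solution of `u - δ² ∇_Γ div_Γ u = φ`, with `g = ∇_Γ div_Γ u`. -/
def SolvesDiv (Ω : Set R3) (δ : ℝ) (φ u g : R3 → C3) : Prop :=
  IsGradDiv Ω u g ∧ (fun x => u x - (δ ^ 2 : ℝ) • g x) =ᵐ[surf Ω] φ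

/-- `(u, g)` is a solution of `u + δ² 𝐜𝐮𝐫𝐥_Γ curl_Γ u = φ`, with `g = 𝐜𝐮𝐫𝐥_Γ curl_Γ u`. -/
def SolvesCurl (Ω : Set R3) (δ : ℝ) (φ u g : R3 → C3) : Prop :=
  IsCurlCurl Ω u g ∧ (fun x => u x + (δ ^ 2 : ℝ) • g x) =ᵐ[surf Ω] φ

/-- The pair `(A φ, ∇_Γ div_Γ A φ)`, where `A = (1 - δ² ∇_Γ div_Γ)⁻¹`. -/
def resolventDiv (Ω : Set R3) (δ : ℝ) (φ : R3 → C3) : (R3 → C3) × (R3 → C3) :=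
  Classical.epsilon fun p => SolvesDiv Ω δ φ p.1 p.2

/-- The pair `(B φ, 𝐜𝐮𝐫𝐥_Γ curl_Γ B φ)`, where `B = (1 + δ² 𝐜𝐮𝐫𝐥_Γ curl_Γ)⁻¹`. -/
def resolventCurl (Ω : Set R3) (δ : ℝ) (φ : R3 → C3) : (R3 → C3) × (R3 → C3) :=
  Classical.epsilon fun p => SolvesCurl Ω δ φ p.1 p.2

/-- The inverse `T⁻¹ φ` exists and is unique (up to equality almost everywhere): `S φ u g` says
that `u` solves `T u = φ`, `g` being an auxiliary expression in `u`. -/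
def UniquelySolvable (Ω : Set R3) (S : (R3 → C3) → (R3 → C3) → (R3 → C3) → Prop)
    (φ : R3 → C3) : Prop :=
  (∃ u g, S φ u g) ∧
    ∀ u g u' g', S φ u g → S φ u' g' → u =ᵐ[surf Ω] u' ∧ g =ᵐ[surf Ω] g'

/-! ### The impedance operators -/

/-- The complex square root of `i` with positive real part. -/
def sqrtI : ℂ := ((Real.sqrt 2 / 2 : ℝ) : ℂ) + Complex.I * ((Real.sqrt 2 / 2 : ℝ) : ℂ)

/-- `𝒟^{δ,1} φ = δ √i φ`. -/
def D1 (δ : ℝ) (φ : R3 → C3) (x : R3) : C3 := ((δ : ℂ) * sqrtI) • φ x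

/-- `𝒟^{δ,2} φ = δ √i φ + δ² (ℋ - 𝒞) φ`. -/
def D2 (Ω : Set R3) (δ : ℝ) (φ : R3 → C3) (x : R3) : C3 :=
  ((δ : ℂ) * sqrtI) • φ x + (δ ^ 2 : ℂ) • act (meanCurvTensor Ω x - curvature Ω x) (φ x)

/-- `𝒟^{δ,3} φ = δ (√i / 2) φ + δ² (ℋ - 𝒞) φ + δ³ / (2 √i) (𝒞² - ℋ² + ε_r ω²) φ
  + (√2 / 4) δ (A φ + δ² 𝐜𝐮𝐫𝐥_Γ curl_Γ B φ) + i (√2 / 4) δ (B φ - δ² ∇_Γ div_Γ A φ)`, where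
`A = (1 - δ² ∇_Γ div_Γ)⁻¹` and `B = (1 + δ² 𝐜𝐮𝐫𝐥_Γ curl_Γ)⁻¹`. -/
def D3 (Ω : Set R3) (εr ω δ : ℝ) (φ : R3 → C3) (x : R3) : C3 :=
  ((δ : ℂ) * (sqrtI / 2)) • φ x
    + (δ ^ 2 : ℂ) • act (meanCurvTensor Ω x - curvature Ω x) (φ x)
    + ((δ : ℂ) ^ 3 / (2 * sqrtI)) •
        (act (curvature Ω x ^ 2 - meanCurvTensor Ω x ^ 2) (φ x) + ((εr * ω ^ 2 : ℝ) : ℂ) • φ x)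
    + (((Real.sqrt 2 / 4 * δ : ℝ) : ℂ)) •
        ((resolventDiv Ω δ φ).1 x + (δ ^ 2 : ℂ) • (resolventCurl Ω δ φ).2 x)
    + (Complex.I * ((Real.sqrt 2 / 4 * δ : ℝ) : ℂ)) •
        ((resolventCurl Ω δ φ).1 x - (δ ^ 2 : ℂ) • (resolventDiv Ω δ φ).2 x)

/-- The impedance operators `𝒟^{δ,k}` for `k = 0, 1, 2, 3` (and `0` for other `k`). -/
def impedance (Ω : Set R3) (εr ω δ : ℝ) (k : ℕ) (φ : R3 → C3) : R3 → C3 :=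
  match k with
  | 1 => D1 δ φ
  | 2 => D2 Ω δ φ
  | 3 => D3 Ω εr ω δ φ
  | _ => 0

end

end GIBC

namespace GIBC

/-! ### The boundary and its normal field -/

namespace IsLocalDefiningFunction

variable {Ω U : Set R3} {ρ : R3 → ℝ} {x : R3}

/-! The principal term of each operator is a multiple of `δ √i`, whose real part is of exact order
`δ`; everything else is either a perturbation of order `δ²` or has a quadratic form with nonnegative
real part.

Curvature terms: the normal is locally the restriction of a smooth field, so `𝒞` and `ℋ` are
continuous on the compact surface and act as bounded operators on `L²_t(Γ)`. The terms carrying `δ²`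
and `δ³` are therefore absorbed once `δ` is small.

Nonlocal terms: with `A = A^δ` and `B = B^δ`, the resolvent equations give `δ² ∇_Γ div_Γ A = A - 1`
and `δ² 𝐜𝐮𝐫𝐥_Γ curl_Γ B = 1 - B`. The two brackets in the third operator become `A + 1 - B` and `B +
1 - A`. The energy identity gives real quadratic forms with `0 ≤ A`, and bounds `A` and `B` by `1`
in norm. Hence the first bracket is nonnegative and the second, multiplied by `i`, contributes no
real part (`nonlocal_bounds`).

The resolvents exist by orthogonal projection onto the closed graph of `δ div_Γ`
(`exists_solvesDiv`). Rotation by `· × n` is an isometry of `L²_t(Γ)` and turns the curl problem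
into the divergence problem (`SolvesCurl.exists_solvesDiv`).

Since `fderivWithin` and Hausdorff measure enter the definitions, two geometric facts are needed:
the tangent plane lies in the tangent cone of the boundary (`mem_tangentConeAt`), and the surface
measure is finite (`isFiniteMeasure_surf`). -/

theorem contDiffAt (h : IsLocalDefiningFunction Ω U ρ) (hx : x ∈ U) :
    ContDiffAt ℝ (⊤ : ℕ∞) ρ x :=
  h.contDiffOn.contDiffAt (h.isOpen.mem_nhds hx)

theorem differentiableAt (h : IsLocalDefiningFunction Ω U ρ) (hx : x ∈ U) :
    DifferentiableAt ℝ ρ x :=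
  (h.contDiffAt hx).differentiableAt (by simp)

/-- A positive value would put the point in the open set `Ω`, which misses its frontier; a negative
value would persist nearby, so `Ω` would not accumulate at the point. -/
theorem eq_zero (h : IsLocalDefiningFunction Ω U ρ) (hΩ : IsOpen Ω) (hx : x ∈ U)
    (hxf : x ∈ frontier Ω) : ρ x = 0 := by
  have hxΩ : x ∉ Ω := by
    rw [hΩ.frontier_eq] at hxf
    exact hxf.2
  refine le_antisymm (not_lt.1 fun hpos => hxΩ ((h.mem_iff x hx).2 hpos)) (not_lt.1 fun hneg => ?_)
  have hev : ∀ᶠ y in 𝓝 x, y ∉ Ω := by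
    filter_upwards [(h.differentiableAt hx).continuousAt.eventually_lt_const hneg,
      h.isOpen.mem_nhds hx] with y hy hyU hyΩ
    exact absurd ((h.mem_iff y hyU).1 hyΩ) hy.not_gt
  obtain ⟨y, hy, hyΩ⟩ := mem_closure_iff_nhds.1 (frontier_subset_closure hxf) _ hev
  exact hy hyΩ

theorem hasDerivAt_line (h : IsLocalDefiningFunction Ω U ρ) (hx : x ∈ U) (v : R3) :
    HasDerivAt (fun t : ℝ => ρ (x + t • v)) (inner ℝ (gradient ρ x) v) 0 := by
  have h1 : HasFDerivAt ρ (InnerProductSpace.toDual ℝ R3 (gradient ρ x)) (x + (0 : ℝ) • v) := by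
    simpa using (h.differentiableAt hx).hasGradientAt.hasFDerivAt
  have h2 : HasDerivAt (fun t : ℝ => x + t • v) v 0 := by
    simpa using ((hasDerivAt_id (0 : ℝ)).smul_const v).const_add x
  have h3 := h1.comp_hasDerivAt (0 : ℝ) h2
  rwa [InnerProductSpace.toDual_apply_apply] at h3

theorem eventually_mem_line (hx : x ∈ U) (h : IsLocalDefiningFunction Ω U ρ) (v : R3) :
    ∀ᶠ t : ℝ in 𝓝[>] 0, x + t • v ∈ U := by
  have hc : ContinuousAt (fun t : ℝ => x + t • v) 0 := by fun_prop
  exact nhdsWithin_le_nhds (hc.preimage_mem_nhds (h.isOpen.mem_nhds (by simpa using hx)))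

theorem eventually_mem (h : IsLocalDefiningFunction Ω U ρ) (hΩ : IsOpen Ω) (hx : x ∈ U)
    (hxf : x ∈ frontier Ω) {v : R3} (hv : 0 < inner ℝ (gradient ρ x) v) :
    ∀ᶠ t : ℝ in 𝓝[>] 0, x + t • v ∈ Ω := by
  have h1 := (h.hasDerivAt_line hx v).tendsto_slope_zero_right
  filter_upwards [h1.eventually_const_lt hv, h.eventually_mem_line hx v, self_mem_nhdsWithin]
    with t ht htU ht0
  refine (h.mem_iff _ htU).2 ?_
  have : (0 : ℝ) < t⁻¹ * ρ (x + t • v) := by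
    simpa [h.eq_zero hΩ hx hxf] using ht
  exact pos_of_mul_pos_right this (inv_nonneg.2 (le_of_lt ht0))

theorem eventually_notMem (h : IsLocalDefiningFunction Ω U ρ) (hΩ : IsOpen Ω) (hx : x ∈ U)
    (hxf : x ∈ frontier Ω) {v : R3} (hv : inner ℝ (gradient ρ x) v < 0) :
    ∀ᶠ t : ℝ in 𝓝[>] 0, x + t • v ∉ Ω := by
  have h1 := (h.hasDerivAt_line hx v).tendsto_slope_zero_right
  filter_upwards [h1.eventually_lt_const hv, h.eventually_mem_line hx v, self_mem_nhdsWithin]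
    with t ht htU ht0 htΩ
  have h2 := (h.mem_iff _ htU).1 htΩ
  have : t⁻¹ * ρ (x + t • v) < 0 := by
    simpa [h.eq_zero hΩ hx hxf] using ht
  exact absurd this (not_lt.2 (mul_nonneg (inv_nonneg.2 (le_of_lt ht0)) h2.le))

theorem norm_normalized (h : IsLocalDefiningFunction Ω U ρ) (hx : x ∈ U) :
    ‖‖gradient ρ x‖⁻¹ • gradient ρ x‖ = 1 :=
  norm_smul_inv_norm (𝕜 := ℝ) (h.gradient_ne_zero x hx)

theorem inner_normalized_pos {v : R3}
    (hv : 0 < inner ℝ (‖gradient ρ x‖⁻¹ • gradient ρ x) v) : 0 < inner ℝ (gradient ρ x) v := by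
  rw [real_inner_smul_left] at hv
  exact pos_of_mul_pos_right hv (by positivity)

theorem inner_normalized_neg {v : R3}
    (hv : inner ℝ (‖gradient ρ x‖⁻¹ • gradient ρ x) v < 0) : inner ℝ (gradient ρ x) v < 0 := by
  have := inner_normalized_pos (ρ := ρ) (v := -v) (by simpa [inner_neg_right] using hv)
  simpa [inner_neg_right] using this

/-- The normalized gradients of two local defining functions agree on the boundary. -/
theorem normalized_unique {U' : Set R3} {ρ' : R3 → ℝ} (h : IsLocalDefiningFunction Ω U ρ)
    (h' : IsLocalDefiningFunction Ω U' ρ') (hΩ : IsOpen Ω) (hx : x ∈ U) (hx' : x ∈ U')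
    (hxf : x ∈ frontier Ω) :
    ‖gradient ρ x‖⁻¹ • gradient ρ x = ‖gradient ρ' x‖⁻¹ • gradient ρ' x := by
  set a := ‖gradient ρ x‖⁻¹ • gradient ρ x with ha
  set b := ‖gradient ρ' x‖⁻¹ • gradient ρ' x with hb
  have na : ‖a‖ = 1 := h.norm_normalized hx
  have nb : ‖b‖ = 1 := h'.norm_normalized hx'
  by_contra hab
  have hlt : inner ℝ a b < (1 : ℝ) := inner_lt_one_iff_real_of_norm_eq_one na nb |>.2 hab
  -- For distinct unit vectors, strict Cauchy–Schwarz makes `a - b` point inwards according to `ρ`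
  -- and outwards according to `ρ'`; short segments in this direction then lie both in and off `Ω`.
  have h1 : 0 < inner ℝ a (a - b) := by
    rw [inner_sub_right, real_inner_self_eq_norm_sq, na]; linarith
  have h2 : inner ℝ b (a - b) < 0 := by
    rw [inner_sub_right, real_inner_self_eq_norm_sq, nb, real_inner_comm]; linarith
  obtain ⟨t, ht1, ht2⟩ := ((h.eventually_mem hΩ hx hxf (inner_normalized_pos h1)).and
    (h'.eventually_notMem hΩ hx' hxf (inner_normalized_neg h2))).exists
  exact ht2 ht1

/-- Makes the choice inside `normal` harmless: one defining function computes the normal on the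
whole boundary patch, so smoothness of its gradient transfers to the normal. -/
theorem normal_eq (h : IsLocalDefiningFunction Ω U ρ) (hΩ : IsOpen Ω) (hx : x ∈ U)
    (hxf : x ∈ frontier Ω) : normal Ω x = ‖gradient ρ x‖⁻¹ • gradient ρ x := by
  have hex : ∃ ν : R3, ∃ (U : Set R3) (ρ : R3 → ℝ),
      x ∈ U ∧ IsLocalDefiningFunction Ω U ρ ∧ ν = ‖gradient ρ x‖⁻¹ • gradient ρ x :=
    ⟨_, U, ρ, hx, h, rfl⟩
  rw [normal, dif_pos hex]
  obtain ⟨U', ρ', hx', h', heq⟩ := Classical.choose_spec hex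
  rw [heq]
  exact h'.normalized_unique h hΩ hx' hx hxf

theorem contDiffOn_gradient (h : IsLocalDefiningFunction Ω U ρ) :
    ContDiffOn ℝ (⊤ : ℕ∞) (gradient ρ) U := by
  have h1 : ContDiffOn ℝ (⊤ : ℕ∞) (fderiv ℝ ρ) U :=
    h.contDiffOn.fderiv_of_isOpen h.isOpen (by norm_cast)
  exact (InnerProductSpace.toDual ℝ R3).symm.toContinuousLinearEquiv.contDiff.comp_contDiffOn h1

theorem contDiffOn_normalized (h : IsLocalDefiningFunction Ω U ρ) :
    ContDiffOn ℝ (⊤ : ℕ∞) (fun y => ‖gradient ρ y‖⁻¹ • gradient ρ y) U :=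
  ((h.contDiffOn_gradient.norm ℝ h.gradient_ne_zero).inv
    fun y hy => norm_ne_zero_iff.2 (h.gradient_ne_zero y hy)).smul h.contDiffOn_gradient

end IsLocalDefiningFunction

/-! ### Global geometry of the boundary: compactness, continuity of the normal, tangent cone. -/

namespace IsSmoothBounded

variable {Ω : Set R3} {x : R3}

theorem isCompact_frontier (hΩ : IsSmoothBounded Ω) : IsCompact (frontier Ω) :=
  Metric.isCompact_of_isClosed_isBounded isClosed_frontier
    (hΩ.isBounded.closure.subset frontier_subset_closure)

theorem norm_normal (hΩ : IsSmoothBounded Ω) (hx : x ∈ frontier Ω) : ‖normal Ω x‖ = 1 := by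
  obtain ⟨U, ρ, hxU, h⟩ := hΩ.smooth_boundary x hx
  rw [h.normal_eq hΩ.isOpen hxU hx]
  exact h.norm_normalized hxU

/-- Near each boundary point the normal extends to a smooth field. -/
theorem exists_normal_extension (hΩ : IsSmoothBounded Ω) (hx : x ∈ frontier Ω) :
    ∃ (U : Set R3) (N : R3 → R3), IsOpen U ∧ x ∈ U ∧ ContDiffOn ℝ (⊤ : ℕ∞) N U ∧
      ∀ y ∈ frontier Ω ∩ U, normal Ω y = N y := by
  obtain ⟨U, ρ, hxU, h⟩ := hΩ.smooth_boundary x hx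
  exact ⟨U, _, h.isOpen, hxU, h.contDiffOn_normalized,
    fun y hy => h.normal_eq hΩ.isOpen hy.2 hy.1⟩

theorem continuousOn_normal (hΩ : IsSmoothBounded Ω) : ContinuousOn (normal Ω) (frontier Ω) := by
  intro x hx
  obtain ⟨U, N, hU, hxU, hN, heq⟩ := hΩ.exists_normal_extension hx
  have h1 : ContinuousWithinAt N (frontier Ω) x :=
    (hN.continuousOn.continuousAt (hU.mem_nhds hxU)).continuousWithinAt
  refine h1.congr_of_eventuallyEq ?_ (heq x ⟨hx, hxU⟩)
  filter_upwards [self_mem_nhdsWithin, nhdsWithin_le_nhds (hU.mem_nhds hxU)] with y hy hyU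
  exact heq y ⟨hy, hyU⟩

/-! ### Tangent vectors and the surface gradient -/

/-- A point of `frontier Ω` lies close to `x + t v` when `v` is tangent and `t` is small. -/
theorem eventually_exists_mem_frontier (hΩ : IsSmoothBounded Ω) (hx : x ∈ frontier Ω) {v : R3}
    (hv : inner ℝ (normal Ω x) v = (0 : ℝ)) {ε : ℝ} (hε : 0 < ε) :
    ∀ᶠ t : ℝ in 𝓝[>] 0, ∃ y ∈ frontier Ω, ‖y - x - t • v‖ ≤ ε * t := by
  obtain ⟨U, ρ, hxU, h⟩ := hΩ.smooth_boundary x hx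
  have hn := hΩ.norm_normal hx
  have hnn : inner ℝ (normal Ω x) (normal Ω x) = (1 : ℝ) := by
    rw [real_inner_self_eq_norm_sq, hn]; norm_num
  -- Tilting `v` by `±ε` along the normal gives one direction that enters `Ω` and one that leaves
  -- it.
  have hp : 0 < inner ℝ (gradient ρ x) (v + ε • normal Ω x) := by
    apply IsLocalDefiningFunction.inner_normalized_pos
    rw [← h.normal_eq hΩ.isOpen hxU hx, inner_add_right, real_inner_smul_right, hnn, hv]
    linarith
  have hm : inner ℝ (gradient ρ x) (v - ε • normal Ω x) < 0 := by
    apply IsLocalDefiningFunction.inner_normalized_neg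
    rw [← h.normal_eq hΩ.isOpen hxU hx, inner_sub_right, real_inner_smul_right, hnn, hv]
    linarith
  filter_upwards [h.eventually_mem hΩ.isOpen hxU hx hp, h.eventually_notMem hΩ.isOpen hxU hx hm,
    self_mem_nhdsWithin] with t ht1 ht2 ht0
  have ht0' : 0 < t := ht0
  set p := x + t • (v + ε • normal Ω x)
  set q := x + t • (v - ε • normal Ω x)
  have hpb : p ∈ Metric.closedBall (x + t • v) (ε * t) := by
    rw [mem_closedBall_iff_norm]
    have : p - (x + t • v) = (t * ε) • normal Ω x := by simp only [p]; module
    rw [this, norm_smul, hn, Real.norm_eq_abs, abs_of_pos (by positivity)]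
    linarith
  have hqb : q ∈ Metric.closedBall (x + t • v) (ε * t) := by
    rw [mem_closedBall_iff_norm]
    have : q - (x + t • v) = -((t * ε) • normal Ω x) := by simp only [q]; module
    rw [this, norm_neg, norm_smul, hn, Real.norm_eq_abs, abs_of_pos (by positivity)]
    linarith
  obtain ⟨y, hyb, hy⟩ : (Metric.closedBall (x + t • v) (ε * t) ∩ frontier Ω).Nonempty := by
    by_contra hcon
    -- A ball missing the frontier would be covered by the disjoint open sets `Ω` and `(closure
    -- Ω)ᶜ`; being connected it would lie in one of them, but it contains `p ∈ Ω` and `q ∉ Ω`.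
    have hsub := (convex_closedBall (x + t • v) (ε * t)).isPreconnected.subset_or_subset
      (u := Ω) (v := (closure Ω)ᶜ) hΩ.isOpen isClosed_closure.isOpen_compl
      (disjoint_compl_right_iff_subset.2 subset_closure) (by
        intro z hz
        by_contra hz'
        refine hcon ⟨z, hz, ?_⟩
        rw [hΩ.isOpen.frontier_eq]
        simp only [mem_union, mem_compl_iff, not_or, not_not] at hz'
        exact ⟨hz'.2, hz'.1⟩)
    rcases hsub with hs | hs
    · exact ht2 (hs hqb)
    · exact hs hpb (subset_closure ht1)
  refine ⟨y, hy, ?_⟩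
  rw [mem_closedBall_iff_norm] at hyb
  rwa [sub_sub]

/-- Boundary points within `t / (n + 1)` of `x + t v`, rescaled by `t⁻¹`, converge to `v`. This
matters because derivatives within the frontier are determined only on its tangent cone. -/
theorem mem_tangentConeAt (hΩ : IsSmoothBounded Ω) (hx : x ∈ frontier Ω) {v : R3}
    (hv : inner ℝ (normal Ω x) v = (0 : ℝ)) : v ∈ tangentConeAt ℝ (frontier Ω) x := by
  have hex : ∀ n : ℕ, ∃ t : ℝ, 0 < t ∧ t < 1 / (n + 1 : ℝ) ∧
      ∃ y ∈ frontier Ω, ‖y - x - t • v‖ ≤ 1 / (n + 1 : ℝ) * t := by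
    intro n
    have hpos : (0 : ℝ) < 1 / (n + 1 : ℝ) := by positivity
    obtain ⟨t, ⟨ht1, ht2⟩, ht3⟩ := ((show ∀ᶠ t : ℝ in 𝓝[>] 0, t ∈ Ioo 0 (1 / (n + 1 : ℝ)) from Ioo_mem_nhdsGT hpos).and
      (hΩ.eventually_exists_mem_frontier hx hv hpos)).exists
    exact ⟨t, ht1, ht2, ht3⟩
  choose t ht0 ht1 y hy hyb using hex
  have hd : Tendsto (fun n => (t n)⁻¹ • (y n - x)) atTop (𝓝 v) := by
    rw [tendsto_iff_norm_sub_tendsto_zero]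
    refine squeeze_zero (fun _ => norm_nonneg _) (fun n => ?_)
      (tendsto_one_div_add_atTop_nhds_zero_nat (𝕜 := ℝ))
    have h1 : (t n)⁻¹ • (y n - x) - v = (t n)⁻¹ • (y n - x - t n • v) := by
      rw [smul_sub _ (y n - x), inv_smul_smul₀ (ht0 n).ne']
    rw [h1, norm_smul, Real.norm_eq_abs, abs_of_pos (inv_pos.2 (ht0 n)), inv_mul_le_iff₀ (ht0 n),
      mul_comm (t n)]
    exact hyb n
  have hc : Tendsto (fun n => ‖(t n)⁻¹‖) atTop atTop := by
    refine tendsto_atTop_mono (fun n => ?_) tendsto_natCast_atTop_atTop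
    rw [Real.norm_eq_abs, abs_of_pos (inv_pos.2 (ht0 n))]
    have h1 := one_div_le_one_div_of_le (ht0 n) (ht1 n).le
    rw [one_div_one_div, one_div] at h1
    linarith
  refine mem_tangentConeAt_of_seq atTop (fun n => (t n)⁻¹) (fun n => y n - x)
    (tangentConeAt.lim_zero atTop hc hd) (Eventually.of_forall fun n => ?_) hd
  simpa using hy n

theorem inner_normal_tangProj (hΩ : IsSmoothBounded Ω) (hx : x ∈ frontier Ω) (v : R3) :
    inner ℝ (normal Ω x) (tangProj Ω x v) = (0 : ℝ) := by
  rw [tangProj, inner_sub_right, real_inner_smul_right, real_inner_self_eq_norm_sq,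
    hΩ.norm_normal hx]
  ring

variable {𝕜 : Type} [RCLike 𝕜]

/-- The frontier does not have unique derivatives in `ℝ³`, so `fderivWithin` is an arbitrary choice
in the normal direction. `surfGrad` evaluates it only on tangent vectors, where any two choices
agree, and so any differentiable extension computes it. -/
theorem surfGrad_apply (hΩ : IsSmoothBounded Ω) (hx : x ∈ frontier Ω) {f F : R3 → 𝕜}
    (hF : DifferentiableAt ℝ F x) (hfF : f =ᶠ[𝓝[frontier Ω] x] F) (i : Fin 3) :
    surfGrad Ω f x i = fderiv ℝ F x (tangProj Ω x (EuclideanSpace.single i (1 : ℝ))) := by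
  have h1 : HasFDerivWithinAt f (fderiv ℝ F x) (frontier Ω) x :=
    hF.hasFDerivAt.hasFDerivWithinAt.congr_of_eventuallyEq hfF (hfF.eq_of_nhdsWithin hx)
  exact h1.differentiableWithinAt.hasFDerivWithinAt.unique_on h1
    (hΩ.mem_tangentConeAt hx (hΩ.inner_normal_tangProj hx _))

theorem continuousOn_tangProj (hΩ : IsSmoothBounded Ω) (v : R3) :
    ContinuousOn (fun x => tangProj Ω x v) (frontier Ω) := by
  unfold tangProj
  have := hΩ.continuousOn_normal
  fun_prop

theorem continuousWithinAt_surfGrad (hΩ : IsSmoothBounded Ω) (hx : x ∈ frontier Ω) {U : Set R3}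
    (hU : IsOpen U) (hxU : x ∈ U) {f F : R3 → 𝕜} (hF : ContDiffOn ℝ (⊤ : ℕ∞) F U)
    (hfF : ∀ y ∈ frontier Ω ∩ U, f y = F y) (i : Fin 3) :
    ContinuousWithinAt (fun y => surfGrad Ω f y i) (frontier Ω) x := by
  have hF' : ContinuousWithinAt (fderiv ℝ F) (frontier Ω) x :=
    ((hF.continuousOn_fderiv_of_isOpen hU (by simp)).continuousAt
      (hU.mem_nhds hxU)).continuousWithinAt
  have h1 : ContinuousWithinAt
      (fun y => fderiv ℝ F y (tangProj Ω y (EuclideanSpace.single i (1 : ℝ)))) (frontier Ω) x :=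
    hF'.clm_apply (hΩ.continuousOn_tangProj _ x hx)
  have key : ∀ y ∈ frontier Ω ∩ U, surfGrad Ω f y i =
      fderiv ℝ F y (tangProj Ω y (EuclideanSpace.single i (1 : ℝ))) := by
    intro y hy
    refine hΩ.surfGrad_apply hy.1
      ((hF.contDiffAt (hU.mem_nhds hy.2)).differentiableAt (by simp)) ?_ i
    filter_upwards [self_mem_nhdsWithin, nhdsWithin_le_nhds (hU.mem_nhds hy.2)] with z hz hzU
    exact hfF z ⟨hz, hzU⟩
  refine h1.congr_of_eventuallyEq ?_ (key x ⟨hx, hxU⟩)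
  filter_upwards [self_mem_nhdsWithin, nhdsWithin_le_nhds (hU.mem_nhds hxU)] with y hy hyU
  exact key y ⟨hy, hyU⟩

theorem continuousOn_surfGrad (hΩ : IsSmoothBounded Ω) {f : R3 → 𝕜}
    (hf : ContDiff ℝ (⊤ : ℕ∞) f) : ContinuousOn (surfGrad Ω f) (frontier Ω) := by
  intro x hx
  have : ContinuousWithinAt (fun y => (surfGrad Ω f y).ofLp) (frontier Ω) x :=
    continuousWithinAt_pi.2 fun i => hΩ.continuousWithinAt_surfGrad hx isOpen_univ (mem_univ x)
      hf.contDiffOn (fun _ _ => rfl) i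
  exact (PiLp.continuous_toLp 2 _).continuousAt.comp_continuousWithinAt this

theorem continuousOn_curvature (hΩ : IsSmoothBounded Ω) :
    ContinuousOn (curvature Ω) (frontier Ω) := by
  intro x hx
  obtain ⟨U, N, hU, hxU, hN, heq⟩ := hΩ.exists_normal_extension hx
  refine continuousWithinAt_pi.2 fun i => continuousWithinAt_pi.2 fun j => ?_
  refine hΩ.continuousWithinAt_surfGrad hx hU hxU (F := fun y => N y j) ?_
    (fun y hy => by rw [heq y hy]) i
  exact (EuclideanSpace.proj (𝕜 := ℝ) j).contDiff.comp_contDiffOn hN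

/-- The sum is the tangential projection of `n = ∑ nᵢ eᵢ` itself, which vanishes because `n` is a
unit vector. -/
theorem sum_normal_mul_single (hΩ : IsSmoothBounded Ω) (hx : x ∈ frontier Ω) :
    ∑ i, normal Ω x i • tangProj Ω x (EuclideanSpace.single i (1 : ℝ)) = 0 := by
  have h1 : ∑ i, normal Ω x i ^ 2 = 1 := by
    have := hΩ.norm_normal hx
    rw [EuclideanSpace.norm_eq, Real.sqrt_eq_one] at this
    simpa using this
  ext j
  simp only [tangProj, Fin.sum_univ_three] at h1 ⊢
  fin_cases j <;> simp [EuclideanSpace.inner_single_right]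
  · linear_combination -(normal Ω x 0 * h1)
  · linear_combination -(normal Ω x 1 * h1)
  · linear_combination -(normal Ω x 2 * h1)

/-- The curvature tensor takes its values in the tangent plane. -/
theorem normal_vecMul_curvature (hΩ : IsSmoothBounded Ω) (hx : x ∈ frontier Ω) :
    (normal Ω x).ofLp ᵥ* curvature Ω x = 0 := by
  ext j
  -- By linearity of the derivative, contracting the row index of `𝒞` with `n` differentiates along
  -- the tangential part of `n`, which is zero. No symmetry of `𝒞` is involved.
  have := congrArg (fderivWithin ℝ (fun y => normal Ω y j) (frontier Ω) x)
    (hΩ.sum_normal_mul_single hx)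
  simpa [Matrix.vecMul, dotProduct, curvature, surfGrad, map_sum] using this

end IsSmoothBounded

/-! ### Finiteness of the surface measure -/

/-- The normalizing constant depends on the dimension `d` only, so it is the same on both sides and
the estimate for Hausdorff measure carries over. -/
theorem _root_.LipschitzOnWith.euclideanHausdorffMeasure_image_le {X Y : Type*} [EMetricSpace X]
    [EMetricSpace Y] [MeasurableSpace X] [BorelSpace X] [MeasurableSpace Y] [BorelSpace Y]
    {K : NNReal} {f : X → Y} {s : Set X} (h : LipschitzOnWith K f s) (d : ℕ) :
    μHE[d] (f '' s) ≤ (K : ENNReal) ^ d * μHE[d] s := by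
  simp only [Measure.euclideanHausdorffMeasure_def, Measure.smul_apply, ENNReal.smul_def,
    smul_eq_mul]
  rw [mul_left_comm]
  gcongr
  simpa using h.hausdorffMeasure_image_le (Nat.cast_nonneg d)

namespace IsSmoothBounded

variable {Ω : Set R3} {x : R3}

/-- Near a boundary point, the orthogonal projection on the tangent plane is bi-Lipschitz on the
boundary. -/
theorem exists_norm_sub_le_projection (hΩ : IsSmoothBounded Ω) (hx : x ∈ frontier Ω) :
    ∃ n : R3, n ≠ 0 ∧ ∃ V ∈ 𝓝 x, ∀ y ∈ frontier Ω ∩ V, ∀ z ∈ frontier Ω ∩ V,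
      ‖y - z‖ ≤ 2 * ‖(ℝ ∙ n)ᗮ.starProjection (y - z)‖ := by
  obtain ⟨U, ρ, hxU, h⟩ := hΩ.smooth_boundary x hx
  have hn := h.gradient_ne_zero x hxU
  set n := gradient ρ x with hndef
  have hnpos : 0 < ‖n‖ := norm_pos_iff.2 hn
  -- Strict differentiability controls `ρ y - ρ z` for all pairs near `x`. On the boundary both
  -- values vanish, so the component of `y - z` along the gradient is at most half its length.
  have hs : HasStrictFDerivAt ρ (fderiv ℝ ρ x) x := (h.contDiffAt hxU).hasStrictFDerivAt (by simp)
  have hev : ∀ᶠ p : R3 × R3 in 𝓝 (x, x),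
      ‖ρ p.1 - ρ p.2 - fderiv ℝ ρ x (p.1 - p.2)‖ ≤ ‖n‖ / 2 * ‖p.1 - p.2‖ :=
    hs.isLittleO.def (by positivity)
  rw [nhds_prod_eq] at hev
  obtain ⟨W, hW, hWp⟩ := mem_prod_same_iff.1 hev
  refine ⟨n, hn, W ∩ U, inter_mem hW (h.isOpen.mem_nhds hxU), fun y hy z hz => ?_⟩
  have h1 : ‖ρ y - ρ z - fderiv ℝ ρ x (y - z)‖ ≤ ‖n‖ / 2 * ‖y - z‖ :=
    hWp (mk_mem_prod hy.2.1 hz.2.1)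
  rw [h.eq_zero hΩ.isOpen hy.2.2 hy.1, h.eq_zero hΩ.isOpen hz.2.2 hz.1] at h1
  have h2 : fderiv ℝ ρ x (y - z) = inner ℝ n (y - z) := by
    rw [hndef, ← toDual_gradient, InnerProductSpace.toDual_apply_apply]
  simp only [sub_self, zero_sub, norm_neg, h2, Real.norm_eq_abs] at h1
  have h3 : ‖(ℝ ∙ n).starProjection (y - z)‖ ≤ ‖y - z‖ / 2 := by
    rw [Submodule.starProjection_singleton, norm_smul, RCLike.ofReal_real_eq_id, id, norm_div,
      Real.norm_eq_abs, Real.norm_eq_abs, abs_of_pos (by positivity : 0 < ‖n‖ ^ 2),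
      div_mul_eq_mul_div, div_le_iff₀ (by positivity)]
    nlinarith
  have h4 := Submodule.norm_sq_eq_add_norm_sq_starProjection (𝕜 := ℝ) (y - z) (ℝ ∙ n)
  have h5 : 0 ≤ ‖(ℝ ∙ n).starProjection (y - z)‖ := norm_nonneg _
  have h6 : 0 ≤ ‖y - z‖ := norm_nonneg _
  -- By Pythagoras the tangential part has square at least `3/4` of `‖y - z‖²`, more than the `1/4`
  -- needed for the factor `2`.
  refine abs_le_of_sq_le_sq' ?_ (by positivity) |>.2
  nlinarith

/-- The boundary patch is the image, under the `2`-Lipschitz inverse of the projection, of a bounded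
subset of a plane, and there the two-dimensional Hausdorff measure is a Haar measure. -/
theorem exists_measure_lt_top (hΩ : IsSmoothBounded Ω) (hx : x ∈ frontier Ω) :
    ∃ V ∈ 𝓝 x, (μHE[2] : Measure R3) (frontier Ω ∩ V) < ⊤ := by
  obtain ⟨n, hn, V, hV, hle⟩ := hΩ.exists_norm_sub_le_projection hx
  refine ⟨V, hV, ?_⟩
  have hfr : Module.finrank ℝ (ℝ ∙ n)ᗮ = 2 := by
    have : Fact (Module.finrank ℝ R3 = 2 + 1) := ⟨by simp⟩
    exact Submodule.finrank_orthogonal_span_singleton hn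
  set π : R3 → (ℝ ∙ n)ᗮ := fun y => (ℝ ∙ n)ᗮ.orthogonalProjectionOnto y with hπ
  set s := frontier Ω ∩ V with hsdef
  have hle' : ∀ y ∈ s, ∀ z ∈ s, dist y z ≤ 2 * dist (π y) (π z) := by
    intro y hy z hz
    rw [dist_eq_norm, dist_eq_norm, hπ]
    simp only
    rw [← map_sub]
    exact hle y hy z hz
  have hinj : InjOn π s := by
    intro y hy z hz hyz
    have := hle' y hy z hz
    rw [hyz, dist_self, mul_zero] at this
    exact dist_le_zero.1 this
  have hlip : LipschitzOnWith 2 (Function.invFunOn π s) (π '' s) := by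
    refine LipschitzOnWith.of_dist_le_mul ?_
    rintro _ ⟨y, hy, rfl⟩ _ ⟨z, hz, rfl⟩
    rw [hinj.leftInvOn_invFunOn hy, hinj.leftInvOn_invFunOn hz]
    exact hle' y hy z hz
  have himage : Function.invFunOn π s '' (π '' s) = s := hinj.invFunOn_image subset_rfl
  have hbound : (μHE[2] : Measure (ℝ ∙ n)ᗮ) (π '' s) < ⊤ := by
    have hb : Bornology.IsBounded (π '' s) := by
      have h1 : Bornology.IsBounded s := hΩ.isCompact_frontier.isBounded.subset inter_subset_left
      exact ((ℝ ∙ n)ᗮ.orthogonalProjectionOnto).lipschitz.isBounded_image h1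
    have := (isAddHaarMeasure_euclideanHausdorffMeasure (E := (ℝ ∙ n)ᗮ))
    rw [hfr] at this
    exact hb.measure_lt_top
  rw [← himage]
  refine (hlip.euclideanHausdorffMeasure_image_le 2).trans_lt (ENNReal.mul_lt_top ?_ hbound)
  exact ENNReal.pow_lt_top ENNReal.coe_lt_top

theorem isFiniteMeasure_surf (hΩ : IsSmoothBounded Ω) : IsFiniteMeasure (surf Ω) := by
  constructor
  rw [surf, Measure.restrict_apply_univ]
  refine hΩ.isCompact_frontier.measure_lt_top_of_nhdsWithin fun x hx => ?_
  obtain ⟨V, hV, hlt⟩ := hΩ.exists_measure_lt_top hx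
  exact ⟨frontier Ω ∩ V, inter_mem self_mem_nhdsWithin (nhdsWithin_le_nhds hV), hlt⟩

theorem ae_mem_frontier : ∀ᵐ x ∂(surf Ω), x ∈ frontier Ω :=
  ae_restrict_mem isClosed_frontier.measurableSet

theorem memLp_of_continuousOn (hΩ : IsSmoothBounded Ω) {E : Type*} [NormedAddCommGroup E]
    {f : R3 → E} (hf : ContinuousOn f (frontier Ω)) (p : ENNReal) : MemLp f p (surf Ω) := by
  have := hΩ.isFiniteMeasure_surf
  obtain ⟨C, hC⟩ := hΩ.isCompact_frontier.exists_bound_of_continuousOn hf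
  refine MemLp.of_bound (hf.aestronglyMeasurable isClosed_frontier.measurableSet) C ?_
  filter_upwards [ae_mem_frontier] with x hx using hC x hx

end IsSmoothBounded

/-! ### Matrices acting on fields -/

/-- The action of real matrices on complex vectors, as a linear map into the continuous
endomorphisms of `ℂ³`. -/
noncomputable def actHom : Matrix (Fin 3) (Fin 3) ℝ →ₗ[ℝ] (C3 →L[ℂ] C3) where
  toFun M := LinearMap.toContinuousLinearMap (Matrix.toEuclideanLin (M.map Complex.ofReal))
  map_add' M N := by
    ext v i
    simp [Matrix.mulVec, dotProduct, add_mul, Finset.sum_add_distrib]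
  map_smul' c M := by
    ext v i
    simp [Matrix.mulVec, dotProduct, Finset.mul_sum, mul_assoc]

theorem actHom_apply (M : Matrix (Fin 3) (Fin 3) ℝ) (v : C3) : actHom M v = act M v := rfl

theorem act_apply (M : Matrix (Fin 3) (Fin 3) ℝ) (v : C3) (i : Fin 3) :
    act M v i = ∑ j, (M i j : ℂ) * v j := rfl

theorem continuous_actHom : Continuous actHom := actHom.continuous_of_finiteDimensional

theorem IsSmoothBounded.exists_act_bound {Ω : Set R3} (hΩ : IsSmoothBounded Ω)
    {M : R3 → Matrix (Fin 3) (Fin 3) ℝ} (hM : ContinuousOn M (frontier Ω)) :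
    ∃ C : ℝ, 0 ≤ C ∧ ∀ x ∈ frontier Ω, ∀ v : C3, ‖act (M x) v‖ ≤ C * ‖v‖ := by
  obtain ⟨C, hC⟩ := hΩ.isCompact_frontier.exists_bound_of_continuousOn
    (continuous_actHom.comp_continuousOn hM)
  refine ⟨max C 0, le_max_right _ _, fun x hx v => ?_⟩
  rw [← actHom_apply]
  exact (actHom (M x)).le_of_opNorm_le ((hC x hx).trans (le_max_left _ _)) v

theorem IsSmoothBounded.memLp_act {Ω : Set R3} (hΩ : IsSmoothBounded Ω)
    {M : R3 → Matrix (Fin 3) (Fin 3) ℝ} (hM : ContinuousOn M (frontier Ω)) {u : R3 → C3}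
    (hu : MemLp u 2 (surf Ω)) : MemLp (fun x => act (M x) (u x)) 2 (surf Ω) := by
  obtain ⟨C, -, hC⟩ := hΩ.exists_act_bound hM
  have h1 : AEStronglyMeasurable (fun x => actHom (M x)) (surf Ω) :=
    (hΩ.memLp_of_continuousOn (continuous_actHom.comp_continuousOn hM) 2).1
  refine MemLp.of_le_mul (c := C) hu ?_ ?_
  · exact isBoundedBilinearMap_apply.continuous.comp_aestronglyMeasurable (h1.prodMk hu.1)
  · filter_upwards [IsSmoothBounded.ae_mem_frontier] with x hx using hC x hx _

/-! ### The inner products of `L²(Γ)` -/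

section InnerProducts

variable {Ω : Set R3} {u v w u' v' : R3 → C3} {d d' e e' : R3 → ℂ}

/-- The arguments are exchanged since `ip` is linear in its first slot and `inner` in its second.
This is the bridge to Hilbert space theory in `L²`. -/
theorem ip_eq_inner (hu : MemLp u 2 (surf Ω)) (hv : MemLp v 2 (surf Ω)) :
    ip Ω u v = inner ℂ (hv.toLp v) (hu.toLp u) := by
  rw [L2.inner_def]
  refine integral_congr_ae ?_
  filter_upwards [hu.coeFn_toLp, hv.coeFn_toLp] with x hx hy
  rw [hx, hy, PiLp.inner_apply]
  simp [RCLike.inner_apply]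

theorem ipScalar_eq_inner (hd : MemLp d 2 (surf Ω)) (he : MemLp e 2 (surf Ω)) :
    ipScalar Ω d e = inner ℂ (he.toLp e) (hd.toLp d) := by
  rw [L2.inner_def]
  refine integral_congr_ae ?_
  filter_upwards [hd.coeFn_toLp, he.coeFn_toLp] with x hx hy
  rw [hx, hy, RCLike.inner_apply]

theorem nrm_nonneg : 0 ≤ nrm Ω u := Real.sqrt_nonneg _

theorem ip_self : ip Ω u u = ((nrm Ω u ^ 2 : ℝ) : ℂ) := by
  rw [nrm, Real.sq_sqrt (integral_nonneg fun x => by positivity), ip, ← integral_complex_ofReal]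
  congr 1
  ext x
  rw [EuclideanSpace.norm_sq_eq]
  push_cast
  simp [Complex.mul_conj']

theorem nrm_eq_norm (hu : MemLp u 2 (surf Ω)) : nrm Ω u = ‖hu.toLp u‖ := by
  have h1 : ((nrm Ω u ^ 2 : ℝ) : ℂ) = ((‖hu.toLp u‖ ^ 2 : ℝ) : ℂ) := by
    rw [← ip_self, ip_eq_inner hu hu, inner_self_eq_norm_sq_to_K]
    push_cast
    rfl
  exact (sq_eq_sq₀ nrm_nonneg (norm_nonneg _)).1 (by exact_mod_cast h1)

theorem ip_congr (hu : u =ᵐ[surf Ω] u') (hv : v =ᵐ[surf Ω] v') : ip Ω u v = ip Ω u' v' :=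
  integral_congr_ae (by filter_upwards [hu, hv] with x hx hy; rw [hx, hy])

theorem nrm_congr (hu : u =ᵐ[surf Ω] u') : nrm Ω u = nrm Ω u' := by
  unfold nrm
  rw [integral_congr_ae (by filter_upwards [hu] with x hx; rw [hx])]

theorem ip_conj : (starRingEnd ℂ) (ip Ω u v) = ip Ω v u := by
  rw [ip, ip, ← integral_conj]
  congr 1
  ext x
  simp [map_sum, mul_comm]

theorem ip_add_left (hu : MemLp u 2 (surf Ω)) (hv : MemLp v 2 (surf Ω))
    (hw : MemLp w 2 (surf Ω)) : ip Ω (fun x => u x + v x) w = ip Ω u w + ip Ω v w := by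
  rw [ip_eq_inner hu hw, ip_eq_inner hv hw, ← inner_add_right, ← MemLp.toLp_add]
  exact ip_eq_inner (hu.add hv) hw

theorem ip_sub_left (hu : MemLp u 2 (surf Ω)) (hv : MemLp v 2 (surf Ω))
    (hw : MemLp w 2 (surf Ω)) : ip Ω (fun x => u x - v x) w = ip Ω u w - ip Ω v w := by
  rw [ip_eq_inner hu hw, ip_eq_inner hv hw, ← inner_sub_right, ← MemLp.toLp_sub]
  exact ip_eq_inner (hu.sub hv) hw

theorem ip_smul_left (c : ℂ) : ip Ω (fun x => c • u x) w = c * ip Ω u w := by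
  rw [ip, ip, ← integral_const_mul]
  congr 1
  ext x
  simp [Finset.mul_sum, mul_assoc]

theorem ip_real_smul_left (c : ℝ) : ip Ω (fun x => c • u x) w = c * ip Ω u w := by
  rw [← ip_smul_left]
  rfl

theorem ipScalar_sub_left (hd : MemLp d 2 (surf Ω)) (hd' : MemLp d' 2 (surf Ω))
    (he : MemLp e 2 (surf Ω)) :
    ipScalar Ω (fun x => d x - d' x) e = ipScalar Ω d e - ipScalar Ω d' e := by
  rw [ipScalar_eq_inner hd he, ipScalar_eq_inner hd' he, ← inner_sub_right, ← MemLp.toLp_sub]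
  exact ipScalar_eq_inner (hd.sub hd') he

theorem exists_ipScalar_self (d : R3 → ℂ) : ∃ r : ℝ, 0 ≤ r ∧ ipScalar Ω d d = r := by
  refine ⟨∫ x, ‖d x‖ ^ 2 ∂(surf Ω), integral_nonneg fun x => by positivity, ?_⟩
  rw [ipScalar, ← integral_complex_ofReal]
  congr 1
  ext x
  rw [Complex.mul_conj']
  push_cast
  rfl

theorem norm_ip_le (hu : MemLp u 2 (surf Ω)) (hv : MemLp v 2 (surf Ω)) :
    ‖ip Ω u v‖ ≤ nrm Ω u * nrm Ω v := by
  rw [ip_eq_inner hu hv, nrm_eq_norm hu, nrm_eq_norm hv, mul_comm]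
  exact norm_inner_le_norm _ _

theorem nrm_add_le (hu : MemLp u 2 (surf Ω)) (hv : MemLp v 2 (surf Ω)) :
    nrm Ω (fun x => u x + v x) ≤ nrm Ω u + nrm Ω v := by
  have h : nrm Ω (fun x => u x + v x) = ‖(hu.add hv).toLp (u + v)‖ := nrm_eq_norm (hu.add hv)
  rw [h, MemLp.toLp_add, nrm_eq_norm hu, nrm_eq_norm hv]
  exact norm_add_le _ _

theorem nrm_sub_le (hu : MemLp u 2 (surf Ω)) (hv : MemLp v 2 (surf Ω)) :
    nrm Ω (fun x => u x - v x) ≤ nrm Ω u + nrm Ω v := by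
  have h : nrm Ω (fun x => u x - v x) = ‖(hu.sub hv).toLp (u - v)‖ := nrm_eq_norm (hu.sub hv)
  rw [h, MemLp.toLp_sub, nrm_eq_norm hu, nrm_eq_norm hv]
  exact norm_sub_le _ _

theorem nrm_smul (c : ℂ) : nrm Ω (fun x => c • u x) = ‖c‖ * nrm Ω u := by
  unfold nrm
  simp only [norm_smul, mul_pow]
  rw [integral_const_mul, Real.sqrt_mul (sq_nonneg _), Real.sqrt_sq (norm_nonneg _)]

theorem nrm_le_of_ae_le {C : ℝ} (hC : 0 ≤ C) (hu : MemLp u 2 (surf Ω))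
    (h : ∀ᵐ x ∂(surf Ω), ‖v x‖ ≤ C * ‖u x‖) : nrm Ω v ≤ C * nrm Ω u := by
  unfold nrm
  rw [← Real.sqrt_sq hC, ← Real.sqrt_mul (sq_nonneg _), ← integral_const_mul]
  refine Real.sqrt_le_sqrt (integral_mono_of_nonneg (ae_of_all _ fun x => by positivity)
    ((hu.integrable_norm_pow (by norm_num)).const_mul _) ?_)
  filter_upwards [h] with x hx
  rw [← mul_pow]
  gcongr

theorem ae_eq_zero_of_nrm (hu : MemLp u 2 (surf Ω)) (h : nrm Ω u = 0) :
    u =ᵐ[surf Ω] fun _ => 0 := by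
  rw [nrm_eq_norm hu, norm_eq_zero] at h
  have h1 := hu.coeFn_toLp
  rw [h] at h1
  exact h1.symm.trans (Lp.coeFn_zero ..)

theorem ae_eq_zero_of_ipScalar (hd : MemLp d 2 (surf Ω)) (h : ipScalar Ω d d = 0) :
    d =ᵐ[surf Ω] fun _ => 0 := by
  rw [ipScalar_eq_inner hd hd, inner_self_eq_zero] at h
  have h1 := hd.coeFn_toLp
  rw [h] at h1
  exact h1.symm.trans (Lp.coeFn_zero ..)

end InnerProducts

/-! ### Tangential fields -/

section Tangential

variable {Ω : Set R3} {u v : R3 → C3}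

theorem dotNormal_add (x : R3) :
    dotNormal Ω (fun x => u x + v x) x = dotNormal Ω u x + dotNormal Ω v x := by
  simp [dotNormal, add_mul, Finset.sum_add_distrib]

theorem dotNormal_smul (c : ℂ) (x : R3) :
    dotNormal Ω (fun x => c • u x) x = c * dotNormal Ω u x := by
  simp [dotNormal, Finset.mul_sum, mul_assoc]

theorem MemL2t.congr (hu : MemL2t Ω u) (h : u =ᵐ[surf Ω] v) : MemL2t Ω v :=
  ⟨hu.1.ae_eq h, by filter_upwards [hu.2, h] with x hx hxv; rw [← hx, dotNormal, dotNormal, hxv]⟩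

theorem MemL2t.add (hu : MemL2t Ω u) (hv : MemL2t Ω v) : MemL2t Ω fun x => u x + v x :=
  ⟨hu.1.add hv.1, by
    filter_upwards [hu.2, hv.2] with x hx hy
    rw [dotNormal_add, hx, hy, add_zero]⟩

theorem MemL2t.smul (hu : MemL2t Ω u) (c : ℂ) : MemL2t Ω fun x => c • u x :=
  ⟨hu.1.const_smul c, by
    filter_upwards [hu.2] with x hx
    rw [dotNormal_smul, hx, mul_zero]⟩

theorem MemL2t.real_smul (hu : MemL2t Ω u) (c : ℝ) : MemL2t Ω fun x => c • u x :=
  hu.smul (c : ℂ)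

theorem MemL2t.sub (hu : MemL2t Ω u) (hv : MemL2t Ω v) : MemL2t Ω fun x => u x - v x :=
  (hu.add (hv.smul (-1))).congr (ae_of_all _ fun x => by simp [sub_eq_add_neg])

namespace IsSmoothBounded

theorem sum_normal_sq (hΩ : IsSmoothBounded Ω) {x : R3} (hx : x ∈ frontier Ω) :
    normal Ω x 0 ^ 2 + normal Ω x 1 ^ 2 + normal Ω x 2 ^ 2 = 1 := by
  have := hΩ.norm_normal hx
  rw [EuclideanSpace.norm_eq, Real.sqrt_eq_one] at this
  simpa [Fin.sum_univ_three] using this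

/-- The matrix of the map `v ↦ v × n`. -/
theorem crossNormal_eq_act (u : R3 → C3) (x : R3) : crossNormal Ω u x =
    act !![0, normal Ω x 2, -normal Ω x 1; -normal Ω x 2, 0, normal Ω x 0;
      normal Ω x 1, -normal Ω x 0, 0] (u x) := by
  ext i
  fin_cases i <;> simp [crossNormal, act_apply, cross_apply, Fin.sum_univ_three] <;> ring

theorem memL2t_crossNormal (hΩ : IsSmoothBounded Ω) (hu : MemLp u 2 (surf Ω)) :
    MemL2t Ω (crossNormal Ω u) := by
  refine ⟨?_, ae_of_all _ fun x => ?_⟩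
  · have hn : ∀ i, ContinuousOn (fun x => normal Ω x i) (frontier Ω) := fun i =>
      (EuclideanSpace.proj (𝕜 := ℝ) i).continuous.comp_continuousOn hΩ.continuousOn_normal
    rw [funext (crossNormal_eq_act u)]
    refine hΩ.memLp_act (continuousOn_pi.2 fun i => continuousOn_pi.2 fun j => ?_) hu
    fin_cases i <;> fin_cases j <;> simp <;>
      first | exact continuousOn_const | exact hn _ | exact (hn _).neg
  · simp [dotNormal, crossNormal, cross_apply, Fin.sum_univ_three]
    ring

theorem crossNormal_congr (h : u =ᵐ[surf Ω] v) :
    crossNormal Ω u =ᵐ[surf Ω] crossNormal Ω v := by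
  filter_upwards [h] with x hx
  rw [crossNormal, crossNormal, hx]

/-- The triple product expands as `(u × n) × n = (u · n) n - (n · n) u`: on tangent planes `· × n`
is a quarter turn. -/
theorem crossNormal_crossNormal (hΩ : IsSmoothBounded Ω) (hu : MemL2t Ω u) :
    crossNormal Ω (crossNormal Ω u) =ᵐ[surf Ω] fun x => -u x := by
  filter_upwards [hu.2, ae_mem_frontier] with x hx hxf
  have h1 := congrArg (fun t : ℝ => (t : ℂ)) (hΩ.sum_normal_sq hxf)
  push_cast at h1
  rw [dotNormal, Fin.sum_univ_three] at hx
  ext i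
  fin_cases i <;> simp [crossNormal, cross_apply]
  · linear_combination (normal Ω x 0 : ℂ) * hx - u x 0 * h1
  · linear_combination (normal Ω x 1 : ℂ) * hx - u x 1 * h1
  · linear_combination (normal Ω x 2 : ℂ) * hx - u x 2 * h1

/-- Lagrange's identity leaves `(u · v̄)(n · n) - (u · n)(n · v̄)`, so tangentiality of one factor
is enough. -/
theorem ip_crossNormal (hΩ : IsSmoothBounded Ω) (hu : MemL2t Ω u) :
    ip Ω (crossNormal Ω u) (crossNormal Ω v) = ip Ω u v := by
  refine integral_congr_ae ?_
  filter_upwards [hu.2, ae_mem_frontier] with x hx hxf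
  have h1 := congrArg (fun t : ℝ => (t : ℂ)) (hΩ.sum_normal_sq hxf)
  push_cast at h1
  rw [dotNormal, Fin.sum_univ_three] at hx
  simp only [Fin.sum_univ_three, crossNormal, cross_apply]
  simp
  set a := (starRingEnd ℂ) (v x 0)
  set b := (starRingEnd ℂ) (v x 1)
  set c := (starRingEnd ℂ) (v x 2)
  linear_combination (u x 0 * a + u x 1 * b + u x 2 * c) * h1 -
    (a * normal Ω x 0 + b * normal Ω x 1 + c * normal Ω x 2) * hx

theorem nrm_crossNormal (hΩ : IsSmoothBounded Ω) (hu : MemL2t Ω u) :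
    nrm Ω (crossNormal Ω u) = nrm Ω u := by
  have h := hΩ.ip_crossNormal (v := u) hu
  rw [ip_self, ip_self] at h
  exact (sq_eq_sq₀ nrm_nonneg nrm_nonneg).1 (by exact_mod_cast h)

theorem crossNormal_add_smul (c : ℝ) (u v : R3 → C3) (x : R3) :
    crossNormal Ω (fun x => u x + c • v x) x = crossNormal Ω u x + c • crossNormal Ω v x := by
  rw [crossNormal_eq_act, crossNormal_eq_act, crossNormal_eq_act, ← actHom_apply, ← actHom_apply,
    ← actHom_apply, map_add, ← Complex.coe_smul, map_smul, Complex.coe_smul]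

end IsSmoothBounded

end Tangential

/-! ### The weak surface divergence -/

section Divergence

variable {Ω : Set R3} {u v g g' φ φ' u' : R3 → C3} {d d' : R3 → ℂ} {δ : ℝ}

/-- The complex conjugate of the surface gradient. -/
noncomputable def conjSurfGrad (Ω : Set R3) (f : R3 → ℂ) (x : R3) : C3 :=
  WithLp.toLp 2 fun i => (starRingEnd ℂ) (surfGrad Ω f x i)

/-- The complexified normal field. -/
noncomputable def normalC (Ω : Set R3) (x : R3) : C3 :=
  WithLp.toLp 2 fun i => (normal Ω x i : ℂ)

/-- The defining pairing is bilinear; conjugating the test function makes it Hermitian, so that weak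
divergence becomes an orthogonality condition. -/
theorem isSurfDiv_iff : IsSurfDiv Ω u d ↔ ∀ f : R3 → ℂ, ContDiff ℝ (⊤ : ℕ∞) f →
    ip Ω u (conjSurfGrad Ω f) = -ipScalar Ω d (fun x => (starRingEnd ℂ) (f x)) := by
  simp [IsSurfDiv, ip, ipScalar, conjSurfGrad]

theorem IsSurfDiv.congr (h : IsSurfDiv Ω u d) (huv : u =ᵐ[surf Ω] v) : IsSurfDiv Ω v d := by
  rw [isSurfDiv_iff] at h ⊢
  intro f hf
  rw [← h f hf, ip_congr huv ae_eq_rfl]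

theorem MemHdiv.congr (h : MemHdiv Ω u d) (huv : u =ᵐ[surf Ω] v) : MemHdiv Ω v d :=
  ⟨h.1.congr huv, h.2.1, h.2.2.congr huv⟩

namespace IsSmoothBounded

theorem memLp_conjSurfGrad (hΩ : IsSmoothBounded Ω) {f : R3 → ℂ} (hf : ContDiff ℝ (⊤ : ℕ∞) f) :
    MemLp (conjSurfGrad Ω f) 2 (surf Ω) := by
  have h1 := hΩ.continuousOn_surfGrad hf
  refine hΩ.memLp_of_continuousOn ?_ 2
  refine (PiLp.continuous_toLp 2 _).comp_continuousOn (continuousOn_pi.2 fun i => ?_)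
  exact Complex.continuous_conj.comp_continuousOn
    ((EuclideanSpace.proj (𝕜 := ℂ) i).continuous.comp_continuousOn h1)

theorem memLp_conj (hΩ : IsSmoothBounded Ω) {f : R3 → ℂ} (hf : ContDiff ℝ (⊤ : ℕ∞) f) :
    MemLp (fun x => (starRingEnd ℂ) (f x)) 2 (surf Ω) :=
  hΩ.memLp_of_continuousOn (Complex.continuous_conj.comp hf.continuous).continuousOn 2

theorem norm_normalC (hΩ : IsSmoothBounded Ω) {x : R3} (hx : x ∈ frontier Ω) :
    ‖normalC Ω x‖ = 1 := by
  rw [← hΩ.norm_normal hx, normalC, EuclideanSpace.norm_eq, EuclideanSpace.norm_eq]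
  simp

theorem continuousOn_normalC (hΩ : IsSmoothBounded Ω) :
    ContinuousOn (normalC Ω) (frontier Ω) :=
  (PiLp.continuous_toLp 2 _).comp_continuousOn (continuousOn_pi.2 fun i =>
    Complex.continuous_ofReal.comp_continuousOn
      ((EuclideanSpace.proj (𝕜 := ℝ) i).continuous.comp_continuousOn hΩ.continuousOn_normal))

theorem memLp_smul_normalC (hΩ : IsSmoothBounded Ω) {e : R3 → ℂ} (he : MemLp e 2 (surf Ω)) :
    MemLp (fun x => e x • normalC Ω x) 2 (surf Ω) :=
  MemLp.of_le he (he.1.smul (hΩ.memLp_of_continuousOn hΩ.continuousOn_normalC 2).1) (by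
    filter_upwards [ae_mem_frontier] with x hx
    rw [norm_smul, hΩ.norm_normalC hx, mul_one])

theorem memLp_dotNormal (hΩ : IsSmoothBounded Ω) (hu : MemLp u 2 (surf Ω)) :
    MemLp (dotNormal Ω u) 2 (surf Ω) := by
  have h1 : dotNormal Ω u = fun x => inner ℂ (normalC Ω x) (u x) := by
    ext x
    simp [dotNormal, normalC, PiLp.inner_apply]
  rw [h1]
  refine MemLp.of_le hu ((hΩ.memLp_of_continuousOn hΩ.continuousOn_normalC 2).1.inner hu.1) ?_
  filter_upwards [ae_mem_frontier] with x hx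
  simpa [hΩ.norm_normalC hx] using norm_inner_le_norm (𝕜 := ℂ) (normalC Ω x) (u x)

theorem ip_smul_normalC (e : R3 → ℂ) :
    ip Ω u (fun x => e x • normalC Ω x) = ipScalar Ω (dotNormal Ω u) e := by
  rw [ip, ipScalar]
  congr 1
  ext x
  simp only [dotNormal, normalC, Finset.sum_mul]
  exact Finset.sum_congr rfl fun i _ => by simp; ring

/-- Tangentiality of a square integrable field is orthogonality to the normal fields. -/
theorem memL2t_iff (hΩ : IsSmoothBounded Ω) (hu : MemLp u 2 (surf Ω)) : MemL2t Ω u ↔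
    ∀ e : R3 → ℂ, MemLp e 2 (surf Ω) → ip Ω u (fun x => e x • normalC Ω x) = 0 := by
  constructor
  · intro h e _
    rw [ip_smul_normalC, ipScalar]
    refine integral_eq_zero_of_ae ?_
    filter_upwards [h.2] with x hx
    simp [hx]
  · intro h
    -- The normal component itself serves as the test coefficient, and its `L²` norm comes out as
    -- zero.
    have h1 := h _ (hΩ.memLp_dotNormal hu)
    rw [ip_smul_normalC] at h1
    exact ⟨hu, ae_eq_zero_of_ipScalar (hΩ.memLp_dotNormal hu) h1⟩

theorem memHdiv_sub (hΩ : IsSmoothBounded Ω) (h : MemHdiv Ω u d) (h' : MemHdiv Ω u' d') :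
    MemHdiv Ω (fun x => u x - u' x) (fun x => d x - d' x) := by
  refine ⟨h.1.sub h'.1, h.2.1.sub h'.2.1, isSurfDiv_iff.2 fun f hf => ?_⟩
  rw [ip_sub_left h.1.1 h'.1.1 (hΩ.memLp_conjSurfGrad hf),
    ipScalar_sub_left h.2.1 h'.2.1 (hΩ.memLp_conj hf), isSurfDiv_iff.1 h.2.2 f hf,
    isSurfDiv_iff.1 h'.2.2 f hf]
  ring

end IsSmoothBounded

theorem IsSurfGrad.sub (hd : MemLp d 2 (surf Ω)) (hd' : MemLp d' 2 (surf Ω))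
    (h : IsSurfGrad Ω d g) (h' : IsSurfGrad Ω d' g') :
    IsSurfGrad Ω (fun x => d x - d' x) (fun x => g x - g' x) := by
  refine ⟨h.1.sub h'.1, fun ψ e hψ => ?_⟩
  rw [ip_sub_left h.1.1 h'.1.1 hψ.1.1, ipScalar_sub_left hd hd' hψ.2.1, h.2 ψ e hψ, h'.2 ψ e hψ]
  ring

/-! ### The resolvent of `∇_Γ div_Γ` -/

theorem SolvesDiv.memL2t_fst (h : SolvesDiv Ω δ φ u g) : MemL2t Ω u := by
  obtain ⟨⟨d, hd, -⟩, -⟩ := h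
  exact hd.1

theorem SolvesDiv.memL2t_snd (h : SolvesDiv Ω δ φ u g) : MemL2t Ω g := by
  obtain ⟨⟨d, -, hd⟩, -⟩ := h
  exact hd.1

theorem SolvesDiv.sub (hΩ : IsSmoothBounded Ω) (h : SolvesDiv Ω δ φ u g)
    (h' : SolvesDiv Ω δ φ' u' g') :
    SolvesDiv Ω δ (fun x => φ x - φ' x) (fun x => u x - u' x) (fun x => g x - g' x) := by
  obtain ⟨⟨d, hd, hg⟩, heq⟩ := h
  obtain ⟨⟨d', hd', hg'⟩, heq'⟩ := h'
  refine ⟨⟨_, hΩ.memHdiv_sub hd hd', hg.sub hd.2.1 hd'.2.1 hg'⟩, ?_⟩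
  filter_upwards [heq, heq'] with x hx hx'
  rw [← hx, ← hx', smul_sub]
  abel

/-- The energy identity. -/
theorem SolvesDiv.exists_ip_eq (h : SolvesDiv Ω δ φ u g) :
    ∃ a : ℝ, ip Ω u φ = a ∧ nrm Ω u ^ 2 ≤ a := by
  obtain ⟨⟨d, hd, hg⟩, heq⟩ := h
  obtain ⟨r, hr0, hr⟩ := exists_ipScalar_self (Ω := Ω) d
  refine ⟨nrm Ω u ^ 2 + δ ^ 2 * r, ?_, le_add_of_nonneg_right (by positivity)⟩
  -- Pair the equation with `u`; testing the weak gradient `g` of `d` against `u`, whose divergence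
  -- is `d`, turns `-δ² (g, u)` into `δ² (d, d) ≥ 0`.
  have h1 : ip Ω φ u = ip Ω u u - (δ ^ 2 : ℝ) * ip Ω g u := by
    rw [← ip_congr heq ae_eq_rfl, ip_sub_left hd.1.1 (hg.1.real_smul _).1 hd.1.1,
      ip_real_smul_left]
  rw [← ip_conj, h1, hg.2 u d hd, hr, ip_self]
  simp

theorem SolvesDiv.nrm_le (hφ : MemL2t Ω φ) (h : SolvesDiv Ω δ φ u g) : nrm Ω u ≤ nrm Ω φ := by
  obtain ⟨a, ha, hle⟩ := h.exists_ip_eq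
  have h1 := norm_ip_le h.memL2t_fst.1 hφ.1
  rw [ha, Complex.norm_real, Real.norm_eq_abs] at h1
  have h2 : nrm Ω u ^ 2 ≤ nrm Ω u * nrm Ω φ := hle.trans ((le_abs_self a).trans h1)
  have h3 : 0 ≤ nrm Ω u := nrm_nonneg
  have h4 : 0 ≤ nrm Ω φ := nrm_nonneg
  nlinarith

theorem SolvesDiv.unique (hΩ : IsSmoothBounded Ω) (hδ : 0 < δ) (hφ : MemL2t Ω φ)
    (h : SolvesDiv Ω δ φ u g) (h' : SolvesDiv Ω δ φ u' g') :
    u =ᵐ[surf Ω] u' ∧ g =ᵐ[surf Ω] g' := by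
  have h1 := h.sub hΩ h'
  have h0 : nrm Ω (fun x => φ x - φ x) = 0 := by simp [nrm]
  have h2 := ae_eq_zero_of_nrm h1.memL2t_fst.1
    (le_antisymm ((h1.nrm_le (hφ.sub hφ)).trans h0.le) nrm_nonneg)
  refine ⟨by filter_upwards [h2] with x hx using sub_eq_zero.1 hx, ?_⟩
  filter_upwards [h2, h1.2] with x hx hx'
  simp only [hx, sub_self, zero_sub, neg_eq_zero, smul_eq_zero] at hx'
  exact sub_eq_zero.1 (hx'.resolve_left (by positivity))

/-- The test elements to which the graph of `δ div_Γ` is orthogonal. -/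
def divTests (Ω : Set R3) (δ : ℝ) : Set (WithLp 2 (Lp C3 2 (surf Ω) × Lp ℂ 2 (surf Ω))) :=
  {q | (∃ f : R3 → ℂ, ContDiff ℝ (⊤ : ℕ∞) f ∧
      ∃ (h₁ : MemLp (conjSurfGrad Ω f) 2 (surf Ω))
        (h₂ : MemLp (fun x => (starRingEnd ℂ) (f x)) 2 (surf Ω)),
        q = WithLp.toLp 2 ((δ : ℂ) • h₁.toLp, h₂.toLp)) ∨
    ∃ e : R3 → ℂ, MemLp e 2 (surf Ω) ∧
      ∃ h : MemLp (fun x => e x • normalC Ω x) 2 (surf Ω), q = WithLp.toLp 2 (h.toLp, 0)}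

/-- Presents the graph `{(u, δ div_Γ u)}` as an orthogonal complement, which makes it closed at
once. One family of tests encodes the weak divergence, the other tangentiality. -/
theorem IsSmoothBounded.mem_divTests_orthogonal (hΩ : IsSmoothBounded Ω) (hδ : 0 < δ)
    (hu : MemLp u 2 (surf Ω)) (hd : MemLp d 2 (surf Ω)) {D : Lp ℂ 2 (surf Ω)}
    (hD : D = (δ : ℂ) • hd.toLp) :
    WithLp.toLp 2 (hu.toLp, D) ∈ (Submodule.span ℂ (divTests Ω δ))ᗮ ↔ MemHdiv Ω u d := by
  have hδ' : (δ : ℂ) ≠ 0 := by exact_mod_cast hδ.ne'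
  rw [Submodule.mem_orthogonal, MemHdiv, hΩ.memL2t_iff hu, isSurfDiv_iff]
  constructor
  · intro h
    refine ⟨fun e he => ?_, hd, fun f hf => ?_⟩
    · have := h _ (Submodule.subset_span (Or.inr ⟨e, he, hΩ.memLp_smul_normalC he, rfl⟩))
      rw [ip_eq_inner hu (hΩ.memLp_smul_normalC he)]
      simpa using this
    · have := h _ (Submodule.subset_span (Or.inl ⟨f, hf, hΩ.memLp_conjSurfGrad hf,
        hΩ.memLp_conj hf, rfl⟩))
      rw [ip_eq_inner hu (hΩ.memLp_conjSurfGrad hf), ipScalar_eq_inner hd (hΩ.memLp_conj hf)]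
      rw [hD, WithLp.prod_inner_apply, inner_smul_left, inner_smul_right, Complex.conj_ofReal,
        ← mul_add, mul_eq_zero] at this
      exact eq_neg_of_add_eq_zero_left (this.resolve_left hδ')
  · rintro ⟨h1, -, h2⟩ q hq
    induction hq using Submodule.span_induction with
    | mem q hq =>
      rcases hq with ⟨f, hf, m1, m2, rfl⟩ | ⟨e, he, m, rfl⟩
      · rw [hD, WithLp.prod_inner_apply, inner_smul_left, inner_smul_right, Complex.conj_ofReal,
          ← mul_add, ← ip_eq_inner hu m1, ← ipScalar_eq_inner hd m2, h2 f hf]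
        simp
      · rw [WithLp.prod_inner_apply, ← ip_eq_inner hu m, h1 e he]
        simp
    | zero => simp
    | add a b _ _ ha hb => rw [inner_add_left, ha, hb, add_zero]
    | smul c a _ ha => rw [inner_smul_left, ha, mul_zero]

/-- Project `(φ, 0)` onto the graph of `δ div_Γ`. The projection is `(u, δ d)` with `d = div_Γ u`,
and orthogonality of the residual `(φ - u, -δ d)` to the graph is the weak form of `u - δ² ∇_Γ d =
φ`. -/
theorem IsSmoothBounded.exists_solvesDiv (hΩ : IsSmoothBounded Ω) (hδ : 0 < δ)
    (hφ : MemL2t Ω φ) : ∃ u g, SolvesDiv Ω δ φ u g := by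
  have hδ' : (δ : ℂ) ≠ 0 := by exact_mod_cast hδ.ne'
  set K := (Submodule.span ℂ (divTests Ω δ))ᗮ with hK
  have hK_complete : CompleteSpace K := by
    rw [hK]
    exact (Submodule.isClosed_orthogonal _).completeSpace_coe
  obtain ⟨p, hp, q, hq, hpq⟩ := @Submodule.exists_add_mem_mem_orthogonal ℂ _ _ _ _ K
    (Submodule.HasOrthogonalProjection.ofCompleteSpace K)
    (WithLp.toLp 2 (hφ.1.toLp, (0 : Lp ℂ 2 (surf Ω))))
  set u : R3 → C3 := ⇑p.fst with hu_def
  set d : R3 → ℂ := fun x => (δ : ℂ)⁻¹ * (⇑p.snd : R3 → ℂ) x with hd_def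
  have hu : MemLp u 2 (surf Ω) := Lp.memLp _
  have hd : MemLp d 2 (surf Ω) := (Lp.memLp p.snd).const_mul _
  have huLp : hu.toLp = p.fst := Lp.toLp_coeFn _ _
  have hdLp : p.snd = (δ : ℂ) • hd.toLp := by
    have : hd.toLp = (δ : ℂ)⁻¹ • p.snd := by
      refine Lp.ext ?_
      filter_upwards [hd.coeFn_toLp, Lp.coeFn_smul (δ : ℂ)⁻¹ p.snd] with x hx hx'
      rw [hx, hx']
      rfl
    rw [this, smul_inv_smul₀ hδ']
  have hud : MemHdiv Ω u d := by
    rw [← hΩ.mem_divTests_orthogonal hδ hu hd hdLp, huLp]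
    exact hp
  have hsub := hφ.sub hud.1
  refine ⟨u, fun x => ((δ ^ 2)⁻¹ : ℝ) • (u x - φ x),
    ⟨d, hud, ((hud.1.sub hφ).real_smul _), fun ψ e hψ => ?_⟩, ae_of_all _ fun x => ?_⟩
  -- Testing the residual against `(ψ, δ e)` gives `(φ - u, ψ) - δ² (d, e) = 0`, which after
  -- division by `δ²` says that `(u - φ) / δ²` is the weak gradient of `d`.
  · have hψK := (hΩ.mem_divTests_orthogonal hδ hψ.1.1 hψ.2.1 rfl).2 hψ
    have h1 := (Submodule.mem_orthogonal _ _).1 hq _ hψK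
    have h2 : q = WithLp.toLp 2 (hφ.1.toLp - hu.toLp, -((δ : ℂ) • hd.toLp)) := by
      rw [huLp, ← hdLp, eq_sub_of_add_eq' hpq.symm]
      exact WithLp.ofLp_injective 2 (Prod.ext (by simp) (by simp))
    rw [h2, WithLp.prod_inner_apply, inner_neg_right, inner_smul_left, inner_smul_right,
      Complex.conj_ofReal, inner_sub_right, ← ip_eq_inner hφ.1 hψ.1.1, ← ip_eq_inner hu hψ.1.1,
      ← ipScalar_eq_inner hd hψ.2.1] at h1
    rw [ip_real_smul_left, ip_sub_left hu hφ.1 hψ.1.1]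
    push_cast
    field_simp
    linear_combination -h1
  · simp only
    rw [smul_inv_smul₀ (by positivity)]
    abel

/-! ### The resolvent of `curl_Γ curl_Γ` -/

/-- Take the cross product of the equation with `n`: `curl_Γ u` is by definition `div_Γ (u × n)`,
and `(G × n) × n = -G` changes the plus sign into a minus. Thus `B` is `A` conjugated by a rotation,
and bounds and uniqueness are inherited. -/
theorem SolvesCurl.exists_solvesDiv (hΩ : IsSmoothBounded Ω) (h : SolvesCurl Ω δ φ u g) :
    ∃ G, MemL2t Ω G ∧ g =ᵐ[surf Ω] crossNormal Ω G ∧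
      SolvesDiv Ω δ (crossNormal Ω φ) (crossNormal Ω u) G := by
  obtain ⟨⟨r, hr, G, hG, hgG⟩, heq⟩ := h
  refine ⟨G, hG.1, hgG, ⟨r, ⟨hΩ.memL2t_crossNormal hr.1.1, hr.2⟩, hG⟩, ?_⟩
  filter_upwards [IsSmoothBounded.crossNormal_congr heq, hΩ.crossNormal_crossNormal hG.1,
    IsSmoothBounded.crossNormal_congr hgG] with x h1 h2 h3
  rw [← h1, IsSmoothBounded.crossNormal_add_smul, h3, h2, smul_neg, sub_eq_add_neg]

theorem SolvesCurl.memL2t_fst (h : SolvesCurl Ω δ φ u g) : MemL2t Ω u := by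
  obtain ⟨⟨r, hr, -⟩, -⟩ := h
  exact hr.1

theorem SolvesCurl.memL2t_snd (hΩ : IsSmoothBounded Ω) (h : SolvesCurl Ω δ φ u g) :
    MemL2t Ω g := by
  obtain ⟨G, hG, hgG, -⟩ := h.exists_solvesDiv hΩ
  exact (hΩ.memL2t_crossNormal hG.1).congr hgG.symm

theorem SolvesCurl.exists_ip_eq (hΩ : IsSmoothBounded Ω) (h : SolvesCurl Ω δ φ u g) :
    ∃ a : ℝ, ip Ω u φ = a ∧ nrm Ω u ^ 2 ≤ a := by
  obtain ⟨G, -, -, hs⟩ := h.exists_solvesDiv hΩ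
  rw [← hΩ.ip_crossNormal h.memL2t_fst, ← hΩ.nrm_crossNormal h.memL2t_fst]
  exact hs.exists_ip_eq

theorem SolvesCurl.nrm_le (hΩ : IsSmoothBounded Ω) (hφ : MemL2t Ω φ)
    (h : SolvesCurl Ω δ φ u g) : nrm Ω u ≤ nrm Ω φ := by
  obtain ⟨G, -, -, hs⟩ := h.exists_solvesDiv hΩ
  rw [← hΩ.nrm_crossNormal h.memL2t_fst, ← hΩ.nrm_crossNormal hφ]
  exact hs.nrm_le (hΩ.memL2t_crossNormal hφ.1)

theorem SolvesCurl.unique (hΩ : IsSmoothBounded Ω) (hδ : 0 < δ) (hφ : MemL2t Ω φ)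
    (h : SolvesCurl Ω δ φ u g) (h' : SolvesCurl Ω δ φ u' g') :
    u =ᵐ[surf Ω] u' ∧ g =ᵐ[surf Ω] g' := by
  obtain ⟨G, -, hgG, hs⟩ := h.exists_solvesDiv hΩ
  obtain ⟨G', -, hgG', hs'⟩ := h'.exists_solvesDiv hΩ
  obtain ⟨h1, h2⟩ := hs.unique hΩ hδ (hΩ.memL2t_crossNormal hφ.1) hs'
  refine ⟨?_, hgG.trans ((IsSmoothBounded.crossNormal_congr h2).trans hgG'.symm)⟩
  filter_upwards [hΩ.crossNormal_crossNormal h.memL2t_fst,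
    hΩ.crossNormal_crossNormal h'.memL2t_fst, IsSmoothBounded.crossNormal_congr h1]
    with x h3 h4 h5
  rwa [h3, h4, neg_inj] at h5

theorem IsSmoothBounded.exists_solvesCurl (hΩ : IsSmoothBounded Ω) (hδ : 0 < δ)
    (hφ : MemL2t Ω φ) : ∃ u g, SolvesCurl Ω δ φ u g := by
  obtain ⟨w, G, hs⟩ := hΩ.exists_solvesDiv hδ (hΩ.memL2t_crossNormal hφ.1)
  obtain ⟨⟨d, hd, hG⟩, heq⟩ := hs
  have hneg : MemL2t Ω fun x => (-1 : ℝ) • w x := hd.1.real_smul _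
  have hw : w =ᵐ[surf Ω] crossNormal Ω (crossNormal Ω fun x => (-1 : ℝ) • w x) := by
    filter_upwards [hΩ.crossNormal_crossNormal hneg] with x hx
    rw [hx]
    simp
  -- Two quarter turns give `-1`, so undoing the rotation requires the sign: `u = (-w) × n`
  -- satisfies `u × n = w`.
  refine ⟨crossNormal Ω fun x => (-1 : ℝ) • w x, crossNormal Ω G,
    ⟨d, ⟨hΩ.memL2t_crossNormal hneg.1, hd.2.1, hd.2.2.congr hw⟩, G, hG, ae_eq_rfl⟩, ?_⟩
  have h1 : (fun x => (-1 : ℝ) • w x + (δ ^ 2 : ℝ) • G x) =ᵐ[surf Ω]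
      fun x => (-1 : ℂ) • crossNormal Ω φ x := by
    filter_upwards [heq] with x hx
    rw [← hx]
    simp
    abel
  filter_upwards [crossNormal_congr h1, hΩ.crossNormal_crossNormal hφ] with x h2 h3
  rw [← crossNormal_add_smul, h2, crossNormal_eq_act, ← actHom_apply, map_smul, actHom_apply,
    ← crossNormal_eq_act (crossNormal Ω φ), h3]
  simp

theorem IsSmoothBounded.solvesDiv_resolventDiv (hΩ : IsSmoothBounded Ω) (hδ : 0 < δ)
    (hφ : MemL2t Ω φ) :
    SolvesDiv Ω δ φ (resolventDiv Ω δ φ).1 (resolventDiv Ω δ φ).2 := by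
  obtain ⟨u, g, h⟩ := hΩ.exists_solvesDiv hδ hφ
  exact Classical.epsilon_spec (p := fun p : (R3 → C3) × (R3 → C3) => SolvesDiv Ω δ φ p.1 p.2)
    ⟨(u, g), h⟩

theorem IsSmoothBounded.solvesCurl_resolventCurl (hΩ : IsSmoothBounded Ω) (hδ : 0 < δ)
    (hφ : MemL2t Ω φ) :
    SolvesCurl Ω δ φ (resolventCurl Ω δ φ).1 (resolventCurl Ω δ φ).2 := by
  obtain ⟨u, g, h⟩ := hΩ.exists_solvesCurl hδ hφ
  exact Classical.epsilon_spec (p := fun p : (R3 → C3) × (R3 → C3) => SolvesCurl Ω δ φ p.1 p.2)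
    ⟨(u, g), h⟩

end Divergence

/-! ### Curvature terms -/

section Curvature

variable {Ω : Set R3} {M : R3 → Matrix (Fin 3) (Fin 3) ℝ} {φ : R3 → C3} {x : R3}

namespace IsSmoothBounded

theorem continuousOn_tangId (hΩ : IsSmoothBounded Ω) :
    ContinuousOn (tangId Ω) (frontier Ω) := by
  have hn : ContinuousOn (fun x => (normal Ω x).ofLp) (frontier Ω) :=
    (PiLp.continuous_ofLp 2 _).comp_continuousOn hΩ.continuousOn_normal
  exact continuousOn_const.sub
    ((continuous_fst.matrix_vecMulVec continuous_snd).comp_continuousOn (hn.prodMk hn))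

theorem continuousOn_meanCurvTensor (hΩ : IsSmoothBounded Ω) :
    ContinuousOn (meanCurvTensor Ω) (frontier Ω) := by
  have h1 : ContinuousOn (meanCurv Ω) (frontier Ω) :=
    (continuous_id.matrix_trace.comp_continuousOn hΩ.continuousOn_curvature).div_const 2
  exact h1.smul hΩ.continuousOn_tangId

theorem normal_vecMul_meanCurvTensor (hΩ : IsSmoothBounded Ω) (hx : x ∈ frontier Ω) :
    (normal Ω x).ofLp ᵥ* meanCurvTensor Ω x = 0 := by
  have h1 : (normal Ω x).ofLp ⬝ᵥ (normal Ω x).ofLp = 1 := by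
    rw [← hΩ.sum_normal_sq hx, dotProduct, Fin.sum_univ_three]
    ring
  rw [meanCurvTensor, tangId, Matrix.vecMul_smul, Matrix.vecMul_sub, Matrix.vecMul_one,
    Matrix.vecMul_vecMulVec, h1]
  simp

theorem memL2t_act (hΩ : IsSmoothBounded Ω) (hM : ContinuousOn M (frontier Ω))
    (hMn : ∀ x ∈ frontier Ω, (normal Ω x).ofLp ᵥ* M x = 0) (hφ : MemLp φ 2 (surf Ω)) :
    MemL2t Ω fun x => act (M x) (φ x) := by
  refine ⟨hΩ.memLp_act hM hφ, ?_⟩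
  filter_upwards [ae_mem_frontier] with x hx
  have h1 : ∀ j, ((normal Ω x 0 * M x 0 j + normal Ω x 1 * M x 1 j + normal Ω x 2 * M x 2 j : ℝ)
      : ℂ) = 0 := by
    intro j
    have := congrFun (hMn x hx) j
    simp only [Matrix.vecMul, dotProduct, Fin.sum_univ_three, Pi.zero_apply] at this
    rw [this, Complex.ofReal_zero]
  have h0 := h1 0
  have h1' := h1 1
  have h2 := h1 2
  push_cast at h0 h1' h2
  simp only [dotNormal, act_apply, Fin.sum_univ_three]
  linear_combination φ x 0 * h0 + φ x 1 * h1' + φ x 2 * h2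

theorem exists_nrm_act_le (hΩ : IsSmoothBounded Ω) (hM : ContinuousOn M (frontier Ω)) :
    ∃ C : ℝ, 0 ≤ C ∧ ∀ φ : R3 → C3, MemLp φ 2 (surf Ω) →
      nrm Ω (fun x => act (M x) (φ x)) ≤ C * nrm Ω φ := by
  obtain ⟨C, hC0, hC⟩ := hΩ.exists_act_bound hM
  refine ⟨C, hC0, fun φ hφ => nrm_le_of_ae_le hC0 hφ ?_⟩
  filter_upwards [ae_mem_frontier] with x hx using hC x hx _

/-- The operator `ℋ - 𝒞` is bounded on `L²_t(Γ)`. -/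
theorem exists_first_order_bound (hΩ : IsSmoothBounded Ω) :
    ∃ C : ℝ, 0 ≤ C ∧ ∀ φ : R3 → C3, MemL2t Ω φ →
      MemL2t Ω (fun x => act (meanCurvTensor Ω x - curvature Ω x) (φ x)) ∧
      nrm Ω (fun x => act (meanCurvTensor Ω x - curvature Ω x) (φ x)) ≤ C * nrm Ω φ := by
  have hM : ContinuousOn (fun x => meanCurvTensor Ω x - curvature Ω x) (frontier Ω) :=
    hΩ.continuousOn_meanCurvTensor.sub hΩ.continuousOn_curvature
  obtain ⟨C, hC0, hC⟩ := hΩ.exists_nrm_act_le hM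
  refine ⟨C, hC0, fun φ hφ => ⟨hΩ.memL2t_act hM (fun x hx => ?_) hφ.1, hC φ hφ.1⟩⟩
  rw [Matrix.vecMul_sub, hΩ.normal_vecMul_meanCurvTensor hx, hΩ.normal_vecMul_curvature hx,
    sub_zero]

/-- The operator `𝒞² - ℋ² + c` is bounded on `L²_t(Γ)`. -/
theorem exists_second_order_bound (hΩ : IsSmoothBounded Ω) (c : ℝ) :
    ∃ C : ℝ, 0 ≤ C ∧ ∀ φ : R3 → C3, MemL2t Ω φ →
      MemL2t Ω (fun x => act (curvature Ω x ^ 2 - meanCurvTensor Ω x ^ 2) (φ x)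
        + (c : ℂ) • φ x) ∧
      nrm Ω (fun x => act (curvature Ω x ^ 2 - meanCurvTensor Ω x ^ 2) (φ x)
        + (c : ℂ) • φ x) ≤ C * nrm Ω φ := by
  have hM : ContinuousOn (fun x => curvature Ω x ^ 2 - meanCurvTensor Ω x ^ 2) (frontier Ω) :=
    (hΩ.continuousOn_curvature.pow 2).sub (hΩ.continuousOn_meanCurvTensor.pow 2)
  obtain ⟨C, hC0, hC⟩ := hΩ.exists_nrm_act_le hM
  refine ⟨C + |c|, by positivity, fun φ hφ => ?_⟩
  have h1 := hΩ.memL2t_act hM (fun x hx => by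
    rw [Matrix.vecMul_sub, pow_two, pow_two, ← Matrix.vecMul_vecMul, ← Matrix.vecMul_vecMul,
      hΩ.normal_vecMul_meanCurvTensor hx, hΩ.normal_vecMul_curvature hx, Matrix.zero_vecMul,
      Matrix.zero_vecMul, sub_zero]) hφ.1
  refine ⟨h1.add (hφ.smul _), (nrm_add_le h1.1 (hφ.smul _).1).trans ?_⟩
  rw [nrm_smul, Complex.norm_real, Real.norm_eq_abs, add_mul]
  exact add_le_add_left (hC φ hφ.1) _

end IsSmoothBounded

end Curvature

/-! ### Continuity and coercivity -/

section Impedance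

variable {Ω : Set R3} {φ w u v gA gB : R3 → C3} {δ : ℝ}

theorem sqrtI_re : sqrtI.re = Real.sqrt 2 / 2 := by simp [sqrtI]

theorem norm_sqrtI : ‖sqrtI‖ = 1 := by
  have h1 : ‖sqrtI‖ ^ 2 = 1 := by
    rw [Complex.sq_norm, Complex.normSq_apply]
    simp only [sqrtI, Complex.add_re, Complex.add_im, Complex.mul_re, Complex.mul_im,
      Complex.ofReal_re, Complex.ofReal_im, Complex.I_re, Complex.I_im]
    nlinarith [Real.sq_sqrt (show (0 : ℝ) ≤ 2 by norm_num)]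
  exact (pow_eq_one_iff_of_nonneg (norm_nonneg _) two_ne_zero).1 h1

theorem sqrt_two_bounds : 1 ≤ Real.sqrt 2 ∧ Real.sqrt 2 ≤ 2 :=
  ⟨Real.one_le_sqrt.2 (by norm_num), Real.sqrt_le_iff.2 (by norm_num)⟩

/-- Lower bound of the quadratic form of a small perturbation. -/
theorem neg_le_re_mul_ip (c : ℂ) {C : ℝ} (hw : MemLp w 2 (surf Ω)) (hφ : MemLp φ 2 (surf Ω))
    (h : nrm Ω w ≤ C * nrm Ω φ) : -(‖c‖ * C * nrm Ω φ ^ 2) ≤ (c * ip Ω w φ).re := by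
  have h1 : ‖c * ip Ω w φ‖ ≤ ‖c‖ * C * nrm Ω φ ^ 2 := by
    rw [norm_mul, mul_assoc]
    refine mul_le_mul_of_nonneg_left ((norm_ip_le hw hφ).trans ?_) (norm_nonneg _)
    nlinarith [nrm_nonneg (Ω := Ω) (u := φ)]
  exact (neg_le_neg h1).trans (neg_le_of_abs_le (Complex.abs_re_le_norm _))

theorem re_mul_ip_self (c : ℂ) : (c * ip Ω φ φ).re = c.re * nrm Ω φ ^ 2 := by
  rw [ip_self, Complex.re_mul_ofReal]

theorem norm_half_sqrtI_inv (hδ : 0 < δ) : ‖(δ : ℂ) ^ 3 / (2 * sqrtI)‖ = δ ^ 3 / 2 := by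
  rw [norm_div, norm_pow, norm_mul, norm_sqrtI, Complex.norm_real, Real.norm_eq_abs,
    abs_of_pos hδ]
  norm_num

theorem coercive_D1 (hφ : MemL2t Ω φ) (hδ : 0 < δ) :
    MemL2t Ω (D1 δ φ) ∧ nrm Ω (D1 δ φ) ≤ 1 * δ * nrm Ω φ ∧
      1 / 2 * δ * nrm Ω φ ^ 2 ≤ (ip Ω (D1 δ φ) φ).re := by
  refine ⟨hφ.smul _, ?_, ?_⟩
  · refine (nrm_smul _).le.trans ?_
    rw [norm_mul, norm_sqrtI, Complex.norm_real, Real.norm_eq_abs, abs_of_pos hδ, mul_one, one_mul]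
  · have h1 : ip Ω (D1 δ φ) φ = ((δ : ℂ) * sqrtI) * ip Ω φ φ := ip_smul_left _
    rw [h1, re_mul_ip_self, Complex.re_ofReal_mul, sqrtI_re]
    have h2 : 0 ≤ δ * nrm Ω φ ^ 2 := by positivity
    nlinarith [sqrt_two_bounds.1]

/-- The smallness condition bounds the curvature term by `δ / 8`, and `√2 / 2 - 1 / 8 ≥ 1 / 4`. -/
theorem coercive_D2 (hφ : MemL2t Ω φ) (hδ : 0 < δ) {C : ℝ}
    (hw : MemL2t Ω (fun x => act (meanCurvTensor Ω x - curvature Ω x) (φ x)))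
    (hwC : nrm Ω (fun x => act (meanCurvTensor Ω x - curvature Ω x) (φ x)) ≤ C * nrm Ω φ)
    (hδ1 : δ * (C + 1) ≤ 1 / 8) :
    MemL2t Ω (D2 Ω δ φ) ∧ nrm Ω (D2 Ω δ φ) ≤ 2 * δ * nrm Ω φ ∧
      1 / 4 * δ * nrm Ω φ ^ 2 ≤ (ip Ω (D2 Ω δ φ) φ).re := by
  have hN : 0 ≤ nrm Ω φ := nrm_nonneg
  have h1 := hφ.smul ((δ : ℂ) * sqrtI)
  have h2 := hw.smul (δ ^ 2 : ℂ)
  have hnorm : ‖(δ ^ 2 : ℂ)‖ = δ ^ 2 := by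
    rw [norm_pow, Complex.norm_real, Real.norm_eq_abs, abs_of_pos hδ]
  have hδC : δ * C ≤ 1 / 8 := by nlinarith
  refine ⟨h1.add h2, (nrm_add_le h1.1 h2.1).trans ?_, ?_⟩
  · rw [nrm_smul, nrm_smul, hnorm, norm_mul, norm_sqrtI, Complex.norm_real, Real.norm_eq_abs,
      abs_of_pos hδ]
    have h3 : δ ^ 2 * nrm Ω (fun x => act (meanCurvTensor Ω x - curvature Ω x) (φ x))
        ≤ δ * (δ * C * nrm Ω φ) := by
      calc _ ≤ δ ^ 2 * (C * nrm Ω φ) := by gcongr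
        _ = _ := by ring
    have h4 : δ * (δ * C * nrm Ω φ) ≤ δ * (1 / 8 * nrm Ω φ) := by gcongr
    nlinarith [mul_nonneg hδ.le hN]
  · have h3 : ip Ω (D2 Ω δ φ) φ = _ := ip_add_left h1.1 h2.1 hφ.1
    rw [h3, ip_smul_left, ip_smul_left, Complex.add_re, re_mul_ip_self, Complex.re_ofReal_mul,
      sqrtI_re]
    have h4 := neg_le_re_mul_ip (δ ^ 2 : ℂ) hw.1 hφ.1 hwC
    rw [hnorm] at h4
    have h5 : δ ^ 2 * C * nrm Ω φ ^ 2 ≤ 1 / 8 * (δ * nrm Ω φ ^ 2) := by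
      calc _ = (δ * C) * (δ * nrm Ω φ ^ 2) := by ring
        _ ≤ _ := by gcongr
    have h6 : 0 ≤ δ * nrm Ω φ ^ 2 := by positivity
    nlinarith [sqrt_two_bounds.1]

/-- The quadratic form and a bound of `δ² ∇_Γ div_Γ A = A - 1`. -/
theorem SolvesDiv.ip_snd (hφ : MemL2t Ω φ) (h : SolvesDiv Ω δ φ u gA) :
    (δ ^ 2 : ℂ) * ip Ω gA φ = ip Ω u φ - ip Ω φ φ ∧ δ ^ 2 * nrm Ω gA ≤ 2 * nrm Ω φ := by
  have hg : (fun x => (δ ^ 2 : ℝ) • gA x) =ᵐ[surf Ω] fun x => u x - φ x := by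
    filter_upwards [h.2] with x hx
    rw [← hx]
    abel
  constructor
  · rw [← ip_sub_left h.memL2t_fst.1 hφ.1 hφ.1, ← ip_congr hg ae_eq_rfl, ip_real_smul_left]
    push_cast
    rfl
  · have h1 : nrm Ω (fun x => (δ ^ 2 : ℝ) • gA x) = δ ^ 2 * nrm Ω gA := by
      have := nrm_smul (Ω := Ω) (u := gA) ((δ ^ 2 : ℝ) : ℂ)
      rw [Complex.norm_real, Real.norm_eq_abs, abs_of_nonneg (by positivity)] at this
      exact this
    rw [← h1, nrm_congr hg]
    have := h.nrm_le hφ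
    linarith [nrm_sub_le h.memL2t_fst.1 hφ.1]

/-- The quadratic form and a bound of `δ² 𝐜𝐮𝐫𝐥_Γ curl_Γ B = 1 - B`. -/
theorem SolvesCurl.ip_snd (hΩ : IsSmoothBounded Ω) (hφ : MemL2t Ω φ)
    (h : SolvesCurl Ω δ φ v gB) :
    (δ ^ 2 : ℂ) * ip Ω gB φ = ip Ω φ φ - ip Ω v φ ∧ δ ^ 2 * nrm Ω gB ≤ 2 * nrm Ω φ := by
  have hg : (fun x => (δ ^ 2 : ℝ) • gB x) =ᵐ[surf Ω] fun x => φ x - v x := by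
    filter_upwards [h.2] with x hx
    rw [← hx]
    abel
  constructor
  · rw [← ip_sub_left hφ.1 h.memL2t_fst.1 hφ.1, ← ip_congr hg ae_eq_rfl, ip_real_smul_left]
    push_cast
    rfl
  · have h1 : nrm Ω (fun x => (δ ^ 2 : ℝ) • gB x) = δ ^ 2 * nrm Ω gB := by
      have := nrm_smul (Ω := Ω) (u := gB) ((δ ^ 2 : ℝ) : ℂ)
      rw [Complex.norm_real, Real.norm_eq_abs, abs_of_nonneg (by positivity)] at this
      exact this
    rw [← h1, nrm_congr hg]
    have := h.nrm_le hΩ hφ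
    linarith [nrm_sub_le hφ.1 h.memL2t_fst.1]

/-- The nonlocal part of the third operator is bounded by `δ`, and its quadratic form is
nonnegative: its real part is that of `A + 1 - B`, and `A ≥ 0`, `B ≤ 1`. -/
theorem nonlocal_bounds (hΩ : IsSmoothBounded Ω) (hφ : MemL2t Ω φ) (hδ : 0 < δ)
    (hA : SolvesDiv Ω δ φ u gA) (hB : SolvesCurl Ω δ φ v gB) :
    let p := fun x => (((Real.sqrt 2 / 4 * δ : ℝ) : ℂ)) • (u x + (δ ^ 2 : ℂ) • gB x)
    let q := fun x => (Complex.I * ((Real.sqrt 2 / 4 * δ : ℝ) : ℂ)) •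
      (v x - (δ ^ 2 : ℂ) • gA x)
    MemL2t Ω p ∧ MemL2t Ω q ∧ nrm Ω p ≤ 2 * δ * nrm Ω φ ∧ nrm Ω q ≤ 2 * δ * nrm Ω φ ∧
      0 ≤ (ip Ω p φ).re ∧ (ip Ω q φ).re = 0 := by
  intro p q
  have hu := hA.memL2t_fst
  have hv := hB.memL2t_fst
  have hgA := hA.memL2t_snd.smul (δ ^ 2 : ℂ)
  have hgB := (hB.memL2t_snd hΩ).smul (δ ^ 2 : ℂ)
  obtain ⟨a, ha, hua⟩ := hA.exists_ip_eq
  obtain ⟨b, hb, -⟩ := hB.exists_ip_eq hΩ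
  have hN : 0 ≤ nrm Ω φ := nrm_nonneg
  have hbN : b ≤ nrm Ω φ ^ 2 := by
    have h1 := norm_ip_le hv.1 hφ.1
    rw [hb, Complex.norm_real, Real.norm_eq_abs] at h1
    nlinarith [le_abs_self b, hB.nrm_le hΩ hφ]
  have hnorm : ‖(δ ^ 2 : ℂ)‖ = δ ^ 2 := by
    rw [norm_pow, Complex.norm_real, Real.norm_eq_abs, abs_of_pos hδ]
  have hr : ‖((Real.sqrt 2 / 4 * δ : ℝ) : ℂ)‖ ≤ δ / 2 := by
    rw [Complex.norm_real, Real.norm_eq_abs, abs_of_nonneg (by positivity)]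
    nlinarith [sqrt_two_bounds.2]
  -- The `3` counts one `‖φ‖` for the resolvent and two for the `δ²` term beside it.
  have hbound : ∀ {c : ℂ} {t : ℝ}, ‖c‖ ≤ δ / 2 → 0 ≤ t → t ≤ 3 * nrm Ω φ →
      ‖c‖ * t ≤ 2 * δ * nrm Ω φ := by
    intro c t hc ht0 ht
    have h1 : ‖c‖ * t ≤ δ / 2 * (3 * nrm Ω φ) := by gcongr
    nlinarith [mul_nonneg hδ.le hN]
  refine ⟨(hu.add hgB).smul _, (hv.sub hgA).smul _, ?_, ?_, ?_, ?_⟩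
  · rw [nrm_smul]
    refine hbound hr nrm_nonneg ((nrm_add_le hu.1 hgB.1).trans ?_)
    rw [nrm_smul, hnorm]
    linarith [hA.nrm_le hφ, (hB.ip_snd hΩ hφ).2]
  · rw [nrm_smul]
    refine hbound (by rwa [norm_mul, Complex.norm_I, one_mul]) nrm_nonneg
      ((nrm_sub_le hv.1 hgA.1).trans ?_)
    rw [nrm_smul, hnorm]
    linarith [hB.nrm_le hΩ hφ, (hA.ip_snd hφ).2]
  · rw [ip_smul_left, ip_add_left hu.1 hgB.1 hφ.1, ip_smul_left, (hB.ip_snd hΩ hφ).1, ha, hb,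
      ip_self, Complex.re_ofReal_mul, ← Complex.ofReal_sub, ← Complex.ofReal_add,
      Complex.ofReal_re]
    have : 0 ≤ a := (sq_nonneg _).trans hua
    exact mul_nonneg (by positivity) (by linarith)
  -- The form of `B + 1 - A` is the real number `b - (a - ‖φ‖²)`, so the factor `i` makes it purely
  -- imaginary.
  · rw [ip_smul_left, ip_sub_left hv.1 hgA.1 hφ.1, ip_smul_left, (hA.ip_snd hφ).1, ha, hb,
      ip_self, mul_assoc, ← Complex.ofReal_sub, ← Complex.ofReal_sub, ← Complex.ofReal_mul,
      Complex.I_mul_re, Complex.ofReal_im, neg_zero]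

/-- Halving the local part leaves `√2 / 4 ≥ 1 / 4`; the curvature terms cost at most `1 / 8` and the
nonlocal ones nothing. In norm the parts add up to `1/2 + 1/8 + 2 + 2 ≤ 5`, all times `δ`. -/
theorem coercive_D3 (hΩ : IsSmoothBounded Ω) {εr ω C C' : ℝ} (hφ : MemL2t Ω φ) (hδ : 0 < δ)
    (hC : 0 ≤ C) (hC' : 0 ≤ C')
    (hw : MemL2t Ω (fun x => act (meanCurvTensor Ω x - curvature Ω x) (φ x)))
    (hwC : nrm Ω (fun x => act (meanCurvTensor Ω x - curvature Ω x) (φ x)) ≤ C * nrm Ω φ)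
    (hz : MemL2t Ω (fun x => act (curvature Ω x ^ 2 - meanCurvTensor Ω x ^ 2) (φ x)
      + ((εr * ω ^ 2 : ℝ) : ℂ) • φ x))
    (hzC : nrm Ω (fun x => act (curvature Ω x ^ 2 - meanCurvTensor Ω x ^ 2) (φ x)
      + ((εr * ω ^ 2 : ℝ) : ℂ) • φ x) ≤ C' * nrm Ω φ)
    (hδ1 : δ * (C + C' + 1) ≤ 1 / 8) :
    MemL2t Ω (D3 Ω εr ω δ φ) ∧ nrm Ω (D3 Ω εr ω δ φ) ≤ 5 * δ * nrm Ω φ ∧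
      1 / 8 * δ * nrm Ω φ ^ 2 ≤ (ip Ω (D3 Ω εr ω δ φ) φ).re := by
  have hN : 0 ≤ nrm Ω φ := nrm_nonneg
  have h1 := hφ.smul ((δ : ℂ) * (sqrtI / 2))
  have h2 := hw.smul (δ ^ 2 : ℂ)
  have h3 := hz.smul ((δ : ℂ) ^ 3 / (2 * sqrtI))
  obtain ⟨h4, h5, hp, hq, hpi, hqi⟩ := nonlocal_bounds hΩ hφ hδ
    (hΩ.solvesDiv_resolventDiv hδ hφ) (hΩ.solvesCurl_resolventCurl hδ hφ)
  have hnorm : ‖(δ ^ 2 : ℂ)‖ = δ ^ 2 := by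
    rw [norm_pow, Complex.norm_real, Real.norm_eq_abs, abs_of_pos hδ]
  have hnorm1 : ‖(δ : ℂ) * (sqrtI / 2)‖ = δ / 2 := by
    rw [norm_mul, norm_div, norm_sqrtI, Complex.norm_real, Real.norm_eq_abs, abs_of_pos hδ]
    norm_num
    ring
  have hδ2 : δ * C + δ * C' ≤ 1 / 8 := by nlinarith
  have hδ3 : δ ≤ 1 := by nlinarith [mul_nonneg hδ.le hC, mul_nonneg hδ.le hC']
  have hsmall : δ ^ 2 * C + δ ^ 3 / 2 * C' ≤ δ / 8 := by
    have e1 : δ ^ 3 * C' ≤ δ ^ 2 * C' :=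
      mul_le_mul_of_nonneg_right (pow_le_pow_of_le_one hδ.le hδ3 (by norm_num)) hC'
    have e2 : 0 ≤ δ ^ 3 * C' := by positivity
    have e3 := mul_le_mul_of_nonneg_left hδ2 hδ.le
    linarith
  refine ⟨(((h1.add h2).add h3).add h4).add h5, ?_, ?_⟩
  · have e1 : nrm Ω (D3 Ω εr ω δ φ) ≤ _ :=
      nrm_add_le (((h1.add h2).add h3).add h4).1 h5.1
    have e2 := nrm_add_le ((h1.add h2).add h3).1 h4.1
    have e3 := nrm_add_le (h1.add h2).1 h3.1
    have e4 := nrm_add_le h1.1 h2.1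
    have e5 : nrm Ω (fun x => ((δ : ℂ) * (sqrtI / 2)) • φ x) = δ / 2 * nrm Ω φ := by
      rw [nrm_smul, hnorm1]
    have e6 := nrm_smul (Ω := Ω) (δ ^ 2 : ℂ)
      (u := fun x => act (meanCurvTensor Ω x - curvature Ω x) (φ x))
    have e7 := nrm_smul (Ω := Ω) ((δ : ℂ) ^ 3 / (2 * sqrtI))
      (u := fun x => act (curvature Ω x ^ 2 - meanCurvTensor Ω x ^ 2) (φ x)
        + ((εr * ω ^ 2 : ℝ) : ℂ) • φ x)
    rw [hnorm] at e6
    rw [norm_half_sqrtI_inv hδ] at e7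
    have e8 := mul_le_mul_of_nonneg_left hwC (sq_nonneg δ)
    have e9 := mul_le_mul_of_nonneg_left hzC (by positivity : 0 ≤ δ ^ 3 / 2)
    have e10 := mul_le_mul_of_nonneg_right hsmall hN
    have e11 := mul_nonneg hδ.le hN
    linarith
  · have e1 : ip Ω (D3 Ω εr ω δ φ) φ = _ :=
      ip_add_left (((h1.add h2).add h3).add h4).1 h5.1 hφ.1
    rw [e1, ip_add_left ((h1.add h2).add h3).1 h4.1 hφ.1, ip_add_left (h1.add h2).1 h3.1 hφ.1,
      ip_add_left h1.1 h2.1 hφ.1]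
    simp only [Complex.add_re]
    have e2 : (ip Ω (fun x => ((δ : ℂ) * (sqrtI / 2)) • φ x) φ).re
        = δ * (Real.sqrt 2 / 2 / 2) * nrm Ω φ ^ 2 := by
      rw [ip_smul_left, re_mul_ip_self, Complex.re_ofReal_mul, Complex.div_ofNat_re, sqrtI_re]
    have e3 := neg_le_re_mul_ip (δ ^ 2 : ℂ) hw.1 hφ.1 hwC
    have e4 := neg_le_re_mul_ip ((δ : ℂ) ^ 3 / (2 * sqrtI)) hz.1 hφ.1 hzC
    rw [← ip_smul_left, hnorm] at e3
    rw [← ip_smul_left, norm_half_sqrtI_inv hδ] at e4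
    have e5 := mul_le_mul_of_nonneg_right hsmall (sq_nonneg (nrm Ω φ))
    have e6 : δ * nrm Ω φ ^ 2 * 1 ≤ δ * nrm Ω φ ^ 2 * Real.sqrt 2 :=
      mul_le_mul_of_nonneg_left sqrt_two_bounds.1 (by positivity)
    linarith

end Impedance

end GIBC

/-! ### Assembly of the theorem. -/

theorem lemma6p1 (Ω : Set GIBC.R3) (hΩ : GIBC.IsSmoothBounded Ω)
    (εr ω : ℝ) (hεr : 0 < εr) (hω : 0 < ω) :
    -- the two inverses in the third operator are well defined on `L²_t(Γ)`
    (∀ δ : ℝ, 0 < δ → ∀ φ : GIBC.R3 → GIBC.C3, GIBC.MemL2t Ω φ →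
      GIBC.UniquelySolvable Ω (GIBC.SolvesDiv Ω δ) φ ∧
      GIBC.UniquelySolvable Ω (GIBC.SolvesCurl Ω δ) φ) ∧
    -- continuity and coercivity
    (∀ k : ℕ, k = 1 ∨ k = 2 ∨ k = 3 →
      ∃ δk C₁ C₂ : ℝ, 0 < δk ∧ 0 < C₁ ∧ 0 < C₂ ∧
        ∀ δ : ℝ, 0 < δ → δ ≤ δk → ∀ φ : GIBC.R3 → GIBC.C3, GIBC.MemL2t Ω φ →
          GIBC.MemL2t Ω (GIBC.impedance Ω εr ω δ k φ) ∧
          GIBC.nrm Ω (GIBC.impedance Ω εr ω δ k φ) ≤ C₁ * δ * GIBC.nrm Ω φ ∧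
          C₂ * δ * GIBC.nrm Ω φ ^ 2 ≤ (GIBC.ip Ω (GIBC.impedance Ω εr ω δ k φ) φ).re) := by
  refine ⟨fun δ hδ φ hφ => ⟨⟨hΩ.exists_solvesDiv hδ hφ, fun u g u' g' h h' =>
    h.unique hΩ hδ hφ h'⟩, ⟨hΩ.exists_solvesCurl hδ hφ, fun u g u' g' h h' =>
    h.unique hΩ hδ hφ h'⟩⟩, ?_⟩
  -- Both curvature bounds are fixed before `δ` and `φ`, so the thresholds built from them are
  -- uniform. The first operator has no perturbation, and its threshold `1` is arbitrary.
  obtain ⟨C, hC0, hC⟩ := hΩ.exists_first_order_bound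
  obtain ⟨C', hC'0, hC'⟩ := hΩ.exists_second_order_bound (εr * ω ^ 2)
  rintro k (rfl | rfl | rfl)
  · exact ⟨1, 1, 1 / 2, by norm_num, by norm_num, by norm_num,
      fun δ hδ _ φ hφ => GIBC.coercive_D1 hφ hδ⟩
  · refine ⟨1 / 8 / (C + 1), 2, 1 / 4, by positivity, by norm_num, by norm_num,
      fun δ hδ hle φ hφ => ?_⟩
    obtain ⟨hw, hwC⟩ := hC φ hφ
    exact GIBC.coercive_D2 hφ hδ hw hwC ((le_div_iff₀ (by positivity)).1 hle)
  · refine ⟨1 / 8 / (C + C' + 1), 5, 1 / 8, by positivity, by norm_num, by norm_num,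
      fun δ hδ hle φ hφ => ?_⟩
    obtain ⟨hw, hwC⟩ := hC φ hφ
    obtain ⟨hz, hzC⟩ := hC' φ hφ
    exact GIBC.coercive_D3 hΩ hφ hδ hC0 hC'0 hw hwC hz hzC
      ((le_div_iff₀ (by positivity)).1 hle)
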